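/- Let $q$ be a prime power and let $m$ be a positive divisor of $q+1$ with $m\neq q+1$. Let $Y\subset\mathbb{P}^2$ be the projective closure, over $\mathbb{F}_{q^2}$, of the affine curve $y^q+y=x^m$ (so $Y$ has equation $y^q+yz^{q-1}=x^mz^{q-m}$), and let $P_\infty=(1:0:0)$ be its point at infinity. Let $E\subseteq Y$ be a zero-dimensional (possibly empty) closed subscheme defined over $\mathbb{F}_{q^2}$, let $d>0$ be an integer, and put $B=Y(\mathbb{F}_{q^2})\setminus(E_{\mathrm{red}}\cup\{P_\infty\})$. Let $\mathcal{B}(d,-E)\subseteq\mathbb{F}_{q^2}^{B}$ be the linear code obtained by evaluating at the points of $B$ (for any fixed choice of homogeneous coordinates of these points) the space $H^0(\mathbb{P}^2,\mathcal{I}_E(d))$ of degree-$d$ forms over $\mathbb{F}_{q^2}$ vanishing on $E$, and let $\mathcal{B}(d,-E)^\perp$ be its dual code with respect to the standard scalar product. Assume $d\le m-2$ and $\deg(E)\le d-1$. Let $\mathbf{w}$ be a nonzero codeword of $\mathcal{B}(d,-E)^\perp$ with support $S\subseteq B$, and assume $\deg(E\cup S)\le 2d+1$, where $S$ is regarded as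 a reduced subscheme of $\mathbb{P}^2$. Then there is a line $L\subseteq\mathbb{P}^2$ defined over $\mathbb{F}_{q^2}$ such that: 1. $S\subseteq L$ and $\deg((E\cup S)\cap L)\ge d+2$ (scheme-theoretic intersection); 2. every $S'\subseteq S\cap L$ with $|S'|=d+2-\deg(E\cap L)$ is the support of a codeword of $\mathcal{B}(d,-E)^\perp$ of weight $d+2-\deg(E\cap L)$; 3. if $\mathbf{w}$ is a minimum-weight codeword of $\mathcal{B}(d,-E)^\perp$ (least weight among the nonzero codewords), then $|S|=d+2-\deg(E\cap L)$. -/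

import Mathlib

open scoped LinearAlgebra.Projectivization

attribute [local instance] MvPolynomial.gradedAlgebra

noncomputable section

namespace HermitianQuotient

variable {F : Type*} [Field F]

/-- The points of the projective plane with coordinates in `F`, with homogeneous coordinates
`(x : y : z)` numbered `0, 1, 2`. -/
abbrev Plane (F : Type*) [Field F] : Type _ := ℙ F (Fin 3 → F)

/-- Homogeneous ideals of `F[x, y, z]`. Such an ideal `I` defines the closed subscheme
`Proj (F[x, y, z] / I)` of the projective plane over `F`; every closed subscheme comes from exactly
one saturated homogeneous ideal. -/
abbrev HomIdeal (F : Type*) [Field F] : Type _ :=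
  HomogeneousIdeal (MvPolynomial.homogeneousSubmodule (Fin 3) F)

/-- `I` is saturated with respect to the irrelevant ideal `(x, y, z)`. For such an `I`, the space
`H⁰(ℙ², ℐ(d))` of the ideal sheaf `ℐ` of the subscheme is the degree-`d` part of `I`. -/
def IsSaturated (I : HomIdeal F) : Prop :=
  ∀ f : MvPolynomial (Fin 3) F, (∀ i, MvPolynomial.X i * f ∈ I) → f ∈ I

/-- The degree-`n` part `I_n` of `I`, as a subspace of the space of forms of degree `n`. -/
def gradedPart (I : HomIdeal F) (n : ℕ) :
    Submodule F (MvPolynomial.homogeneousSubmodule (Fin 3) F n) :=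
  (I.toIdeal.restrictScalars F).comap (MvPolynomial.homogeneousSubmodule (Fin 3) F n).subtype

/-- The Hilbert function `n ↦ dim_F (F[x, y, z]_n / I_n)`. -/
def hilbertFn (I : HomIdeal F) (n : ℕ) : ℕ :=
  Module.finrank F (MvPolynomial.homogeneousSubmodule (Fin 3) F n ⧸ gradedPart I n)

/-- The subscheme defined by `I` is zero-dimensional (or empty): its Hilbert polynomial is
constant. -/
def IsZeroDim (I : HomIdeal F) : Prop :=
  ∃ δ : ℕ, ∀ᶠ n in Filter.atTop, hilbertFn I n = δ

/-- The degree of the zero-dimensional subscheme defined by `I`: the eventual value of the Hilbert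
function. It does not change when `I` is replaced by its saturation. -/
def degree (I : HomIdeal F) : ℕ :=
  sInf {δ : ℕ | ∀ᶠ n in Filter.atTop, hilbertFn I n = δ}

/-- A form `f` vanishes at the point `P`. For homogeneous `f` this does not depend on the chosen
homogeneous coordinates of `P`. -/
def VanishesAt (f : MvPolynomial (Fin 3) F) (P : Plane F) : Prop :=
  MvPolynomial.eval P.rep f = 0

/-- The ideal of a set of points with its reduced structure. -/
def pointsIdeal (S : Set (Plane F)) : HomIdeal F :=
  ⟨Ideal.span {f | ∃ n, f.IsHomogeneous n ∧ ∀ P ∈ S, VanishesAt f P},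
    Ideal.homogeneous_span _ _ (by
      rintro f ⟨n, hf, -⟩
      exact ⟨n, (MvPolynomial.mem_homogeneousSubmodule n f).2 hf⟩)⟩

/-- A line of the projective plane defined over `F`, given by a nonzero linear form. -/
structure Line (F : Type*) [Field F] where
  form : MvPolynomial (Fin 3) F
  isHomogeneous : form.IsHomogeneous 1
  ne_zero : form ≠ 0

/-- The ideal of a line. -/
def Line.ideal (L : Line F) : HomIdeal F :=
  ⟨Ideal.span {L.form}, Ideal.homogeneous_span _ _ (by
    rintro f rfl
    exact ⟨1, (MvPolynomial.mem_homogeneousSubmodule 1 _).2 L.isHomogeneous⟩)⟩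

/-- The `F`-points of a line. -/
def Line.points (L : Line F) : Set (Plane F) := {P | VanishesAt L.form P}

/-- The union of two subschemes: the intersection of the ideals. -/
def union (I J : HomIdeal F) : HomIdeal F := I ⊓ J

/-- The scheme-theoretic intersection of two subschemes: the sum of the ideals. -/
def inter (I J : HomIdeal F) : HomIdeal F := I ⊔ J

/-- The homogeneous equation `y^q + y z^(q-1) - x^m z^(q-m)` of the projective closure `Y` of
the affine curve `y^q + y = x^m`, for `1 ≤ m ≤ q`. -/
def curveForm (F : Type*) [Field F] (q m : ℕ) : MvPolynomial (Fin 3) F :=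
  .X 1 ^ q + .X 1 * .X 2 ^ (q - 1) - .X 0 ^ m * .X 2 ^ (q - m)

/-- The `F`-rational points of `Y`. -/
def curvePoints (F : Type*) [Field F] (q m : ℕ) : Set (Plane F) :=
  {P | VanishesAt (curveForm F q m) P}

/-- The point `(1 : 0 : 0)`. -/
def pInfty (F : Type*) [Field F] : Plane F :=
  Projectivization.mk F ![1, 0, 0] (fun h => one_ne_zero (congrFun h 0))

/-- The `F`-rational points of (the reduction of) the subscheme defined by `I`. -/
def redPoints (I : HomIdeal F) : Set (Plane F) := {P | ∀ f ∈ I, VanishesAt f P}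

/-- The evaluation set `B = Y(F) \ (E_red ∪ {P_∞})`. -/
def evalSet (q m : ℕ) (E : HomIdeal F) : Set (Plane F) :=
  curvePoints F q m \ (redPoints E ∪ {pInfty F})

instance [Fintype F] (q m : ℕ) (E : HomIdeal F) : Fintype (evalSet q m E) :=
  Fintype.ofFinite _

/-- The uncomplete code `ℬ(d, -E)`: evaluations on `B` of the degree-`d` forms in the ideal of `E`,
each point `P` being given by the homogeneous coordinate vector `coord P`. -/
def uncompleteCode (coord : Plane F → Fin 3 → F) (q m d : ℕ) (E : HomIdeal F) :
    Submodule F (evalSet q m E → F) :=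
  (gradedPart E d).map
    (LinearMap.pi fun P : evalSet q m E =>
      (MvPolynomial.aeval (coord P) : MvPolynomial (Fin 3) F →ₐ[F] F).toLinearMap ∘ₗ
        (MvPolynomial.homogeneousSubmodule (Fin 3) F d).subtype)

/-- The dual of a linear code, with respect to the standard scalar product. -/
def dualCode {ι : Type*} [Fintype ι] (C : Submodule F (ι → F)) : Submodule F (ι → F) where
  carrier := {w | ∀ c ∈ C, c ⬝ᵥ w = 0}
  add_mem' := fun ha hb c hc => by rw [dotProduct_add, ha c hc, hb c hc, add_zero]
  zero_mem' := fun c _ => dotProduct_zero c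
  smul_mem' := fun a w hw c hc => by rw [dotProduct_smul, hw c hc, smul_zero]

/-- The support of a word indexed by a set of points, as a set of points of the plane. -/
def wordSupport {B : Set (Plane F)} (w : B → F) : Set (Plane F) :=
  Subtype.val '' Function.support w

/-- `w` is a minimum-weight codeword of the linear code `C`: a nonzero codeword of least Hamming
weight among the nonzero codewords. -/
def IsMinWeight [DecidableEq F] {ι : Type*} [Fintype ι] (C : Submodule F (ι → F)) (w : ι → F) :
    Prop :=
  w ∈ C ∧ w ≠ 0 ∧ ∀ v ∈ C, v ≠ 0 → hammingNorm w ≤ hammingNorm v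

end HermitianQuotient

end

open Module

namespace HermitianQuotient

/-! ### Filtration of an algebra by the powers of a subspace containing 1 -/

section FilteredAlgebra

variable {F : Type*} [Field F] {A : Type*} [CommRing A] [Algebra F A] {U : Submodule F A}

/-! Choose a line `l = 0` missing `Z = E ∪ S` and set `l = 1`. Subschemes of `Z` become
finite-dimensional algebras whose dimension is the degree; in each, the image `U` of the linear
forms contains 1 and generates, and `U ^ n` is the image of the forms of degree `n`. A codeword is a
weighted sum of evaluations at `S` killing the degree-`d` forms of `E`. From the ideal of `E` it
extends to a functional `θ ≠ 0` on all polynomials that kills every form of degree `d` and the ideal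
of `Z`.

Modulo the largest ideal inside its kernel, `θ` is nondegenerate, and the quotient has dimension at
most `2 * d + 1`. By `finrank_le_two_of_nondegenerate` a nonzero linear form `L` dies there.
Elements of `E` separate the points of `S`, so `L` vanishes on `S`, and `θ` descends to `Z ∩ L`. The
powers of `U` grow strictly until they fill the algebra, so a nonzero functional killing `U ^ d`
needs dimension at least `d + 2`. Conversely, on a line `U ^ d` has dimension at most `d + 1`, so
dimension `d + 2` leaves room for a nonzero functional killing it, and the same lower bound forbids
a zero weight (`exists_relation_of_line`).

The algebraic core is an induction on `d`. If `U` had dimension 3, then each nonzero `L ∈ U` would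
generate an ideal of codimension at most one. Nondegeneracy forces a step at which `U ^ n` grows by
at most one, and `exists_mul_mem_pow_of_finrank_le` then gives a nonzero `L` whose ideal lies in a
proper `U ^ M`. Equal dimensions put 1 in that ideal, which is absurd. -/

theorem pow_le_pow_succ_of_one_mem (h1 : (1 : A) ∈ U) (n : ℕ) : U ^ n ≤ U ^ (n + 1) :=
  pow_le_pow_right' (Submodule.one_le.2 h1) n.le_succ

theorem pow_mono_of_one_mem (h1 : (1 : A) ∈ U) {m n : ℕ} (h : m ≤ n) : U ^ m ≤ U ^ n :=
  pow_le_pow_right' (Submodule.one_le.2 h1) h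

theorem one_mem_pow (h1 : (1 : A) ∈ U) (n : ℕ) : (1 : A) ∈ U ^ n :=
  pow_mono_of_one_mem h1 n.zero_le (pow_zero U ▸ Submodule.one_le.1 le_rfl)

theorem exists_pow_eq_top [FiniteDimensional F A] (h1 : (1 : A) ∈ U)
    (hgen : ∀ x : A, ∃ n, x ∈ U ^ n) : ∃ n, U ^ n = ⊤ := by
  obtain ⟨s, hs⟩ := (Module.Finite.fg_top : (⊤ : Submodule F A).FG)
  choose f hf using hgen
  refine ⟨s.sup f, top_le_iff.1 (hs ▸ Submodule.span_le.2 fun x hx => ?_)⟩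
  exact pow_mono_of_one_mem h1 (Finset.le_sup hx) (hf x)

/-- One equality in the chain propagates to all later steps, and generation then makes `U ^ n`
everything. -/
theorem pow_lt_pow_succ (h1 : (1 : A) ∈ U) (hgen : ∀ x : A, ∃ n, x ∈ U ^ n) {n : ℕ}
    (hn : U ^ n ≠ ⊤) : U ^ n < U ^ (n + 1) := by
  refine lt_of_le_of_ne (pow_le_pow_succ_of_one_mem h1 n) fun h => hn ?_
  have key : ∀ k, U ^ (n + k) = U ^ n := by
    intro k
    induction k with
    | zero => rfl
    | succ k ih => rw [← add_assoc, pow_succ, ih, ← pow_succ, ← h]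
  refine eq_top_iff.2 fun x _ => ?_
  obtain ⟨k, hk⟩ := hgen x
  rw [← key k]
  exact pow_mono_of_one_mem h1 (by lia) hk

theorem succ_le_finrank_pow [FiniteDimensional F A] (h1 : (1 : A) ∈ U)
    (hgen : ∀ x : A, ∃ n, x ∈ U ^ n) (n : ℕ) (hn : U ^ n ≠ ⊤) : n + 1 ≤ finrank F ↥(U ^ n) := by
  induction n with
  | zero =>
    have : Nontrivial A := by
      by_contra h
      rw [not_nontrivial_iff_subsingleton] at h
      exact hn (Subsingleton.elim _ _)
    refine Submodule.one_le_finrank_iff.2 fun h => one_ne_zero (α := A) ?_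
    rw [← Submodule.mem_bot F, ← h]
    exact one_mem_pow h1 0
  | succ n ih =>
    have hn' : U ^ n ≠ ⊤ := fun h => hn (top_le_iff.1 (h ▸ pow_le_pow_succ_of_one_mem h1 n))
    have := Submodule.finrank_lt_finrank_of_lt (pow_lt_pow_succ h1 hgen hn')
    have := ih hn'
    lia

theorem add_two_le_finrank [FiniteDimensional F A] (h1 : (1 : A) ∈ U)
    (hgen : ∀ x : A, ∃ n, x ∈ U ^ n) {n : ℕ} (hn : U ^ n ≠ ⊤) : n + 2 ≤ finrank F A := by
  have h := succ_le_finrank_pow h1 hgen n hn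
  have := Submodule.finrank_lt hn
  lia

/-- `U` lies in the span of 1 and a single element `b`, so `U ^ n` consists of polynomials of degree
at most `n` in `b`. This is the case of a subscheme of a line. -/
theorem finrank_pow_le_succ [FiniteDimensional F A] (h1 : (1 : A) ∈ U) (hU : finrank F U ≤ 2)
    (n : ℕ) : finrank F ↥(U ^ n) ≤ n + 1 := by
  by_cases hnt : Nontrivial A
  swap
  · rw [not_nontrivial_iff_subsingleton] at hnt
    rw [finrank_zero_of_subsingleton]
    lia
  obtain ⟨b, hb⟩ : ∃ b : A, U ≤ Submodule.span F {1, b} := by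
    by_cases h : U ≤ Submodule.span F {1}
    · exact ⟨1, by simpa using h⟩
    obtain ⟨b, hbU, hb⟩ := SetLike.not_le_iff_exists.1 h
    refine ⟨b, (Submodule.eq_of_le_of_finrank_le (?_ : Submodule.span F {1, b} ≤ U) ?_).ge⟩
    · rw [Submodule.span_le]
      rintro x (rfl | rfl)
      exacts [h1, hbU]
    · refine hU.trans ?_
      have hli : LinearIndependent F ![1, b] := by
        rw [LinearIndependent.pair_iff' one_ne_zero]
        rintro a rfl
        exact hb (Submodule.smul_mem _ _ (Submodule.mem_span_singleton_self _))
      have := finrank_span_eq_card hli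
      rw [Matrix.range_cons, Matrix.range_cons, Matrix.range_empty, Set.union_empty,
        Set.singleton_union, Fintype.card_fin] at this
      exact this.ge
  have key : U ^ n ≤ Submodule.span F (Set.range fun i : Fin (n + 1) => b ^ (i : ℕ)) := by
    induction n with
    | zero =>
      rw [pow_zero, Submodule.one_eq_span, Submodule.span_le]
      rintro x rfl
      exact Submodule.subset_span ⟨0, by simp⟩
    | succ n ih =>
      rw [pow_succ]
      refine (mul_le_mul' ih hb).trans ?_
      rw [Submodule.span_mul_span, Submodule.span_le]
      rintro _ ⟨_, ⟨i, rfl⟩, y, (rfl | rfl), rfl⟩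
      · exact Submodule.subset_span ⟨i.castSucc, by simp⟩
      · exact Submodule.subset_span ⟨i.succ, by simp [pow_succ]⟩
  refine (Submodule.finrank_mono key).trans ((finrank_range_le_card _).trans ?_)
  simp

/-- The image of a generating filtration in a quotient algebra is generating. -/
theorem exists_mem_map_pow (hgen : ∀ x : A, ∃ n, x ∈ U ^ n) (J : Ideal A) (x : A ⧸ J) :
    ∃ n, x ∈ (U.map (Ideal.Quotient.mkₐ F J).toLinearMap) ^ n := by
  obtain ⟨y, rfl⟩ := Ideal.Quotient.mkₐ_surjective F J x
  obtain ⟨n, hn⟩ := hgen y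
  refine ⟨n, ?_⟩
  rw [← Submodule.map_pow]
  exact ⟨y, hn, rfl⟩

/-- The functional on the quotient by the annihilator of `x` induced by `y ↦ θ (y * x)`. -/
def mulFunctional (θ : A →ₗ[F] F) (x : A) :
    (A ⧸ LinearMap.ker (LinearMap.toSpanSingleton A A x)) →ₗ[F] F :=
  θ ∘ₗ ((LinearMap.ker (LinearMap.toSpanSingleton A A x)).liftQ
    (LinearMap.toSpanSingleton A A x) le_rfl).restrictScalars F

theorem mulFunctional_mk (θ : A →ₗ[F] F) (x y : A) :
    mulFunctional θ x (Ideal.Quotient.mkₐ F _ y) = θ (y * x) := rfl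

theorem finrank_quotient_ker_toSpanSingleton (x : A) :
    finrank F (A ⧸ LinearMap.ker (LinearMap.toSpanSingleton A A x)) =
      finrank F ↥((Ideal.span {x}).restrictScalars F) := by
  rw [((LinearMap.toSpanSingleton A A x).quotKerEquivRange.restrictScalars F).finrank_eq,
    LinearMap.range_toSpanSingleton]
  rfl

/-- Under the nondegenerate pairing `θ (x * y)`, the subspaces `U ^ i` and `U ^ j` are orthogonal.
-/
theorem finrank_pow_add_finrank_pow_le [FiniteDimensional F A] {θ : A →ₗ[F] F}
    (hnd : ∀ x, (∀ y, θ (x * y) = 0) → x = 0) {i j : ℕ} (hθ : ∀ x ∈ U ^ (i + j), θ x = 0) :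
    finrank F ↥(U ^ i) + finrank F ↥(U ^ j) ≤ finrank F A := by
  let φ : A →ₗ[F] Dual F A := LinearMap.compr₂ (LinearMap.mul F A) θ
  have hφ : Function.Injective φ := by
    rw [injective_iff_map_eq_zero]
    exact fun x hx => hnd x fun y => LinearMap.congr_fun hx y
  have h : (U ^ i).map φ ≤ (U ^ j).dualAnnihilator := by
    rintro _ ⟨x, hx, rfl⟩
    rw [Submodule.mem_dualAnnihilator]
    intro y hy
    exact hθ _ (pow_add U i j ▸ Submodule.mul_mem_mul hx hy)
  have h' := Submodule.finrank_mono h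
  rw [← (Submodule.equivMapOfInjective φ hφ (U ^ i)).finrank_eq] at h'
  have := Subspace.finrank_add_finrank_dualAnnihilator_eq (U ^ j)
  lia

/-- If the filtration `U ^ n` grows by at most one dimension at a step `i` before it becomes
everything, then some nonscalar element of `U` lowers the filtration from degree `i` on. -/
theorem exists_mul_mem_pow_of_finrank_le [FiniteDimensional F A] (h1 : (1 : A) ∈ U)
    (hgen : ∀ x : A, ∃ n, x ∈ U ^ n) (hU : finrank F U = 3) {i : ℕ} (hi : U ^ i ≠ ⊤)
    (hstep : finrank F ↥(U ^ (i + 1)) ≤ finrank F ↥(U ^ i) + 1) :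
    ∃ L ∈ U, L ≠ 0 ∧ ∀ n, i + 1 ≤ n → ∀ x ∈ U ^ (n + 1), L * x ∈ U ^ n := by
  have hmul : ∀ {n : ℕ} {x y : A}, x ∈ U → y ∈ U ^ n → x * y ∈ U ^ (n + 1) := fun hx hy =>
    pow_succ' U _ ▸ Submodule.mul_mem_mul hx hy
  have hle := fun n => pow_le_pow_succ_of_one_mem h1 n
  -- As the growth is at most one, a single product `g * u` spans `U ^ (i + 1)` modulo `U ^ i`.
  obtain ⟨g, hg, u, hu, hgu⟩ : ∃ g ∈ U, ∃ u ∈ U ^ i, g * u ∉ U ^ i := by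
    by_contra! h
    refine (pow_lt_pow_succ h1 hgen hi).not_ge ?_
    rw [pow_succ']
    exact Submodule.mul_le.2 fun g hg u hu => h g hg u hu
  have hsup : ∀ x ∈ U ^ (i + 1), ∃ v ∈ U ^ i, ∃ r : F, x = v + r • (g * u) := by
    have hlt : U ^ i < U ^ i ⊔ Submodule.span F {g * u} :=
      left_lt_sup.2 fun h => hgu (h (Submodule.mem_span_singleton_self _))
    have heq : U ^ i ⊔ Submodule.span F {g * u} = U ^ (i + 1) := by
      refine Submodule.eq_of_le_of_finrank_le (sup_le (hle i) ?_) ?_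
      · rw [Submodule.span_singleton_le_iff_mem]
        exact hmul hg hu
      · have := Submodule.finrank_lt_finrank_of_lt hlt
        lia
    intro x hx
    rw [← heq, Submodule.mem_sup] at hx
    obtain ⟨v, hv, y, hy, rfl⟩ := hx
    obtain ⟨r, rfl⟩ := Submodule.mem_span_singleton.1 hy
    exact ⟨v, hv, r, rfl⟩
  -- The elements `c ∈ U` with `c * u ∈ U ^ i` span `U` together with `g`. They turn out to preserve
  -- `U ^ n` for every `n ≥ i + 1`.
  have hdec : ∀ x ∈ U, ∃ c ∈ U, c * u ∈ U ^ i ∧ ∃ r : F, x = c + r • g := by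
    intro x hx
    obtain ⟨v, hv, r, hr⟩ := hsup _ (hmul hx hu)
    refine ⟨x - r • g, U.sub_mem hx (U.smul_mem r hg), ?_, r, by simp⟩
    rw [sub_mul, smul_mul_assoc, hr, add_sub_cancel_right]
    exact hv
  have hsplit : ∀ n, (∀ c ∈ U, c * u ∈ U ^ i → ∀ x ∈ U ^ n, c * x ∈ U ^ n) →
      ∀ x ∈ U ^ (n + 1), ∃ y ∈ U ^ n, ∃ z ∈ U ^ n, x = y + g * z := by
    intro n hn x hx
    suffices h : U ^ (n + 1) ≤ U ^ n ⊔ (U ^ n).map (LinearMap.mulLeft F g) by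
      obtain ⟨y, hy, _, ⟨z, hz, rfl⟩, rfl⟩ := Submodule.mem_sup.1 (h hx)
      exact ⟨y, hy, z, hz, rfl⟩
    rw [pow_succ', Submodule.mul_le]
    intro a ha b hb
    obtain ⟨c, hc, hcu, r, rfl⟩ := hdec a ha
    rw [add_mul]
    refine Submodule.add_mem_sup (hn c hc hcu b hb) ⟨r • b, Submodule.smul_mem _ _ hb, ?_⟩
    simp
  have hstab : ∀ n, i + 1 ≤ n → ∀ c ∈ U, c * u ∈ U ^ i → ∀ x ∈ U ^ n, c * x ∈ U ^ n := by
    intro n hn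
    induction n, hn using Nat.le_induction with
    | base =>
      intro c hc hcu x hx
      obtain ⟨v, hv, r, rfl⟩ := hsup x hx
      rw [mul_add, mul_smul_comm, mul_left_comm]
      exact Submodule.add_mem _ (hmul hc hv) (Submodule.smul_mem _ _ (hmul hg hcu))
    | succ n hn ih =>
      intro c hc hcu x hx
      obtain ⟨y, hy, z, hz, rfl⟩ := hsplit n ih x hx
      rw [mul_add, mul_left_comm]
      exact Submodule.add_mem _ (hle n (ih c hc hcu y hy)) (hmul hg (ih c hc hcu z hz))
  have htop : ∀ x ∈ U ^ (i + 2), ∃ v ∈ U ^ (i + 1), ∃ r : F, x = v + r • (g * (g * u)) := by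
    intro x hx
    obtain ⟨y, hy, z, hz, rfl⟩ := hsplit (i + 1) (hstab _ le_rfl) x hx
    obtain ⟨v, hv, r, rfl⟩ := hsup z hz
    exact ⟨y + g * v, Submodule.add_mem _ hy (hmul hg hv), r, by
      rw [mul_add, mul_smul_comm, add_assoc]⟩
  -- Dimension 3 enters here: scalars and `g` alone span at most two dimensions.
  obtain ⟨c, hc, hcu, hc1⟩ : ∃ c ∈ U, c * u ∈ U ^ i ∧ c ∉ Submodule.span F {(1 : A)} := by
    by_contra! h
    classical
    have hUle : U ≤ Submodule.span F (({1, g} : Finset A) : Set A) := by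
      intro x hx
      obtain ⟨c, hc, hcu, r, rfl⟩ := hdec x hx
      refine Submodule.add_mem _ (Submodule.span_mono ?_ (h c hc hcu))
        (Submodule.smul_mem _ _ (Submodule.subset_span ?_)) <;> simp
    have := Submodule.finrank_mono hUle
    have : finrank F (Submodule.span F (({1, g} : Finset A) : Set A)) ≤ _ :=
      finrank_span_finset_le_card (R := F) ({1, g} : Finset A)
    have : ({1, g} : Finset A).card ≤ 2 := Finset.card_le_two
    lia
  -- `c` acts on `U ^ (i + 2)` modulo `U ^ (i + 1)`, which is spanned by the class of `g * (g * u)`,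
  -- as a scalar `r`. Hence `c - r` lowers the filtration there, and multiplication by `g` carries
  -- this upwards.
  obtain ⟨v, hv, r, hr⟩ := htop (c * (g * (g * u)))
    (hstab _ (by lia) c hc hcu _ (hmul hg (hmul hg hu)))
  have hLU : c - r • 1 ∈ U := U.sub_mem hc (U.smul_mem r h1)
  have hLu : (c - r • 1) * u ∈ U ^ i := by
    rw [sub_mul, smul_mul_assoc, one_mul]
    exact Submodule.sub_mem _ hcu (Submodule.smul_mem _ _ hu)
  refine ⟨c - r • 1, hLU, ?_, ?_⟩
  · intro h
    exact hc1 (Submodule.mem_span_singleton.2 ⟨r, (sub_eq_zero.1 h).symm⟩)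
  · intro n hn
    induction n, hn using Nat.le_induction with
    | base =>
      intro x hx
      obtain ⟨y, hy, s, rfl⟩ := htop x hx
      rw [mul_add, mul_smul_comm]
      refine Submodule.add_mem _ (hstab _ le_rfl _ hLU hLu y hy) (Submodule.smul_mem _ _ ?_)
      rw [sub_mul, hr, smul_mul_assoc, one_mul, add_sub_cancel_right]
      exact hv
    | succ n hn ih =>
      intro x hx
      obtain ⟨y, hy, z, hz, rfl⟩ := hsplit (n + 1) (hstab _ (by lia)) x hx
      rw [mul_add, mul_left_comm]
      exact Submodule.add_mem _ (hle n (ih y hy)) (hmul hg (ih z hz))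

end FilteredAlgebra

/-! ### Algebras with a nondegenerate functional -/

section Gorenstein

universe u

variable {F : Type*} [Field F]

/-- The ideal of `L` is isomorphic to the quotient by the annihilator of `L`, on which `y ↦ θ (y *
L)` is nonzero and kills the `d`-th power of the image of `U`. -/
theorem add_two_le_finrank_span_singleton {A : Type*} [CommRing A] [Algebra F A]
    [FiniteDimensional F A] {U : Submodule F A} (h1 : (1 : A) ∈ U)
    (hgen : ∀ x : A, ∃ n, x ∈ U ^ n) {θ : A →ₗ[F] F} (hnd : ∀ x, (∀ y, θ (x * y) = 0) → x = 0)
    {d : ℕ} (hθ : ∀ x ∈ U ^ (d + 1), θ x = 0) {L : A} (hL : L ∈ U) (hL0 : L ≠ 0) :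
    d + 2 ≤ finrank F ↥((Ideal.span {L}).restrictScalars F) := by
  rw [← finrank_quotient_ker_toSpanSingleton]
  refine add_two_le_finrank (U := U.map (Ideal.Quotient.mkₐ F _).toLinearMap) ⟨1, h1, map_one (Ideal.Quotient.mkₐ F _)⟩
    (exists_mem_map_pow hgen _) fun htop => hL0 (hnd L fun y => ?_)
  have hy : Ideal.Quotient.mkₐ F (LinearMap.ker (LinearMap.toSpanSingleton A A L)) y ∈
    (U.map (Ideal.Quotient.mkₐ F _).toLinearMap) ^ d := htop ▸ Submodule.mem_top
  rw [← Submodule.map_pow] at hy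
  obtain ⟨z, hz, hzy⟩ := hy
  have := congrArg (mulFunctional θ L) hzy
  rw [mulFunctional_mk] at this
  rw [mul_comm, ← this]
  exact hθ _ (pow_succ U d ▸ Submodule.mul_mem_mul hz hL)

/-- A finite-dimensional algebra of dimension at most `2 * d + 1`, generated by two elements, which
carries a nondegenerate functional vanishing on the polynomials of degree at most `d` in the
generators, is generated by one element, of degree one in the generators. -/
theorem finrank_le_two_of_nondegenerate (d : ℕ) : ∀ {A : Type u} [CommRing A] [Algebra F A]
    [FiniteDimensional F A] [Nontrivial A] {U : Submodule F A} (_ : (1 : A) ∈ U)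
    (_ : ∀ x : A, ∃ n, x ∈ U ^ n) (_ : finrank F U ≤ 3) {θ : A →ₗ[F] F}
    (_ : ∀ x, (∀ y, θ (x * y) = 0) → x = 0) (_ : ∀ x ∈ U ^ d, θ x = 0)
    (_ : finrank F A ≤ 2 * d + 1), finrank F U ≤ 2 := by
  induction d with
  | zero =>
    intro A _ _ _ _ U h1 hgen hU θ hnd hθ hdim
    have := Submodule.finrank_le U
    lia
  | succ d ih =>
    intro A _ _ _ _ U h1 hgen hU θ hnd hθ hdim
    by_contra! hU2
    have hU3 : finrank F U = 3 := by lia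
    have hrank : ∀ L ∈ U, L ≠ 0 → d + 2 ≤ finrank F ↥((Ideal.span {L}).restrictScalars F) :=
      fun L hL hL0 => add_two_le_finrank_span_singleton h1 hgen hnd hθ hL hL0
    have hbig : ∀ L ∈ U, L ≠ 0 → 2 * d + 2 ≤ finrank F ↥((Ideal.span {L}).restrictScalars F) := by
      intro L hL hL0
      by_contra! hlt
      -- If no nonzero element of `U` kills `L`, then `U` keeps dimension 3 modulo the annihilator
      -- of `L`, against the induction hypothesis.
      obtain ⟨L', hL', hL'0, hLL'⟩ : ∃ L' ∈ U, L' ≠ 0 ∧ L' * L = 0 := by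
        by_contra! hinj
        let f := (Ideal.Quotient.mkₐ F (LinearMap.ker (LinearMap.toSpanSingleton A A L))).toLinearMap
        have hker : ∀ x, f x = 0 ↔ x * L = 0 := fun x => by
          change Ideal.Quotient.mk _ x = 0 ↔ _
          rw [Ideal.Quotient.eq_zero_iff_mem, LinearMap.mem_ker]
          rfl
        have hfin : finrank F ↥(U.map f) = 3 := by
          rw [← hU3, ← LinearMap.range_domRestrict]
          refine LinearMap.finrank_range_of_inj ((injective_iff_map_eq_zero _).2 fun x hx => ?_)
          by_contra hx0
          exact hinj x x.2 (by simpa using hx0) ((hker x).1 hx)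
        have hdimq := finrank_quotient_ker_toSpanSingleton (F := F) L
        have hL2 := hrank L hL hL0
        have : Nontrivial (A ⧸ LinearMap.ker (LinearMap.toSpanSingleton A A L)) :=
          nontrivial_of_finrank_pos (R := F) (by lia)
        have := ih (U := U.map f) (θ := mulFunctional θ L) ⟨1, h1, map_one (Ideal.Quotient.mkₐ F _)⟩
          (exists_mem_map_pow hgen _) hfin.le ?_ ?_ (by lia)
        · lia
        · intro x hx
          obtain ⟨a, rfl⟩ := Ideal.Quotient.mkₐ_surjective F _ x
          refine (hker a).2 (hnd _ fun y => ?_)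
          have := hx (Ideal.Quotient.mkₐ F _ y)
          rwa [← map_mul, mulFunctional_mk, mul_right_comm] at this
        · intro x hx
          rw [← Submodule.map_pow] at hx
          obtain ⟨z, hz, rfl⟩ := hx
          exact hθ _ (pow_succ U d ▸ Submodule.mul_mem_mul hz hL)
      have hrange : (Ideal.span {L}).restrictScalars F = LinearMap.range (LinearMap.mulLeft F L) := by
        ext x
        simp only [Submodule.restrictScalars_mem, Ideal.mem_span_singleton', LinearMap.mem_range,
          LinearMap.mulLeft_apply, mul_comm L]
      have hker : (Ideal.span {L'}).restrictScalars F ≤ LinearMap.ker (LinearMap.mulLeft F L) := by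
        intro x hx
        obtain ⟨y, rfl⟩ := Ideal.mem_span_singleton'.1 hx
        rw [LinearMap.mem_ker, LinearMap.mulLeft_apply, mul_left_comm, mul_comm L, hLL', mul_zero]
      -- The two ideals are the image and part of the kernel of multiplication by `L`; twice `d + 2`
      -- exceeds `2 * d + 3`.
      have h2 := hrank L hL hL0
      have h3 := hrank L' hL' hL'0
      have h4 := Submodule.finrank_mono hker
      have h5 := (LinearMap.mulLeft F L).finrank_range_add_finrank_ker
      rw [← hrange] at h5
      lia
    have hne : U ^ (d + 1) ≠ ⊤ := by
      intro h
      refine one_ne_zero (α := A) (hnd 1 fun y => hθ _ ?_)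
      rw [h]
      exact Submodule.mem_top
    -- Orthogonality to `U ^ 0`, of dimension at least one, makes `i = d + 1` a witness. At the
    -- least such `i` the dimension passes from at least `2 * i - 1` to at most `2 * i`.
    have hex : ∃ i, i ≤ d + 1 ∧ finrank F ↥(U ^ i) ≤ 2 * i := by
      have := finrank_pow_add_finrank_pow_le hnd (i := 0) (j := d + 1) (by simpa using hθ)
      by_contra! h
      have := h 0 (by lia)
      have := h (d + 1) le_rfl
      lia
    classical
    obtain ⟨hid, hi⟩ := Nat.find_spec hex
    have hmin := fun k => Nat.find_min hex (m := k)
    generalize Nat.find hex = i at hid hi hmin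
    have hlow : ∀ k ≤ d + 1, U ^ k ≠ ⊤ := fun k hk h =>
      hne (top_le_iff.1 (h ▸ pow_mono_of_one_mem h1 hk))
    obtain _ | k := i
    · have := succ_le_finrank_pow h1 hgen 0 (hlow 0 (by lia))
      lia
    have hk : 2 * k + 1 ≤ finrank F ↥(U ^ k) := by
      by_contra! h
      exact hmin k (by lia) ⟨by lia, by lia⟩
    obtain ⟨L, hLU, hL0, hL⟩ := exists_mul_mem_pow_of_finrank_le h1 hgen hU3 (hlow k (by lia))
      (by lia)
    have htop := exists_pow_eq_top h1 hgen
    have hN := Nat.find_spec htop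
    have hNmin := fun k => Nat.find_min htop (m := k)
    generalize Nat.find htop = N at hN hNmin
    have hdN : d + 1 < N := by
      by_contra! h
      exact hlow N h hN
    obtain _ | M := N
    · lia
    have hle : (Ideal.span {L}).restrictScalars F ≤ U ^ M := by
      intro x hx
      obtain ⟨y, rfl⟩ := Ideal.mem_span_singleton'.1 hx
      rw [mul_comm]
      exact hL M (by lia) y (hN ▸ Submodule.mem_top)
    have hMtop := hNmin M (by lia)
    have hlt := Submodule.finrank_lt hMtop
    -- `U ^ M` is proper, so its dimension is at most `2 * d + 2`, which the ideal of `L` already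
    -- attains.
    have heq := Submodule.eq_of_le_of_finrank_le hle (by have := hbig L hLU hL0; lia)
    have h1L : (1 : A) ∈ (Ideal.span {L}).restrictScalars F := heq ▸ one_mem_pow h1 M
    refine hMtop (heq ▸ eq_top_iff.2 fun x _ => ?_)
    rw [Submodule.restrictScalars_mem] at h1L ⊢
    rw [(Ideal.eq_top_iff_one _).2 h1L]
    exact Submodule.mem_top

end Gorenstein

/-! ### Hilbert functions and dehomogenization -/

section Graded

open MvPolynomial

variable {F : Type*} [Field F]

theorem homogeneousComponent_succ_mul {l : MvPolynomial (Fin 3) F} (hl : l.IsHomogeneous 1)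
    (g : MvPolynomial (Fin 3) F) (n : ℕ) :
    homogeneousComponent (n + 1) (l * g) = l * homogeneousComponent n g := by
  induction g using MvPolynomial.induction_on' with
  | monomial s c =>
    rw [homogeneousComponent_of_mem (isHomogeneous_monomial c rfl),
      homogeneousComponent_of_mem (hl.mul (isHomogeneous_monomial c rfl))]
    by_cases h : n = s.degree
    · rw [if_pos h, if_pos (by lia)]
    · rw [if_neg h, if_neg (by lia), mul_zero]
  | add p q hp hq => simp [mul_add, hp, hq]

theorem homogeneousComponent_zero_mul {l : MvPolynomial (Fin 3) F} (hl : l.IsHomogeneous 1)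
    (g : MvPolynomial (Fin 3) F) : homogeneousComponent 0 (l * g) = 0 := by
  induction g using MvPolynomial.induction_on' with
  | monomial s c =>
    rw [homogeneousComponent_of_mem (hl.mul (isHomogeneous_monomial c rfl)), if_neg (by lia)]
  | add p q hp hq => rw [mul_add, map_add, hp, hq, add_zero]

theorem component_mem (I : HomIdeal F) {f : MvPolynomial (Fin 3) F} (hf : f ∈ I.toIdeal) (n : ℕ) :
    homogeneousComponent n f ∈ I.toIdeal :=
  homogeneousComponent_mem_of_mem I.is_homogeneous' hf n

theorem mem_iff_component_mem (I : HomIdeal F) (f : MvPolynomial (Fin 3) F) :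
    f ∈ I.toIdeal ↔ ∀ n, homogeneousComponent n f ∈ I.toIdeal :=
  mem_iff_homogeneousComponent_mem I.is_homogeneous' f

instance finite_homogeneousSubmodule (n : ℕ) :
    FiniteDimensional F (homogeneousSubmodule (Fin 3) F n) :=
  Module.Finite.iff_fg.2 (homogeneousSubmodule_fg (Fin 3) F n)

theorem finrank_homogeneousSubmodule_one : finrank F (homogeneousSubmodule (Fin 3) F 1) = 3 := by
  rw [homogeneousSubmodule_one_eq_span_X, finrank_span_eq_card, Fintype.card_fin]
  exact (MvPolynomial.algebraicIndependent_X (Fin 3) F).linearIndependent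

/-- The image of the forms of degree `n` in the quotient by an ideal. -/
noncomputable abbrev formsImage (J : Ideal (MvPolynomial (Fin 3) F)) (n : ℕ) :
    Submodule F (MvPolynomial (Fin 3) F ⧸ J) :=
  (homogeneousSubmodule (Fin 3) F n).map (Ideal.Quotient.mkₐ F J).toLinearMap

theorem mem_formsImage {J : Ideal (MvPolynomial (Fin 3) F)} {n : ℕ}
    {x : MvPolynomial (Fin 3) F ⧸ J} :
    x ∈ formsImage J n ↔ ∃ f : MvPolynomial (Fin 3) F, f.IsHomogeneous n ∧
      Ideal.Quotient.mk J f = x := Iff.rfl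

theorem hilbertFn_eq_finrank_formsImage (I : HomIdeal F) (n : ℕ) :
    hilbertFn I n = finrank F (formsImage I.toIdeal n) := by
  let f := (Ideal.Quotient.mkₐ F I.toIdeal).toLinearMap ∘ₗ
    (homogeneousSubmodule (Fin 3) F n).subtype
  have hker : LinearMap.ker f = gradedPart I n := by
    ext x
    change Ideal.Quotient.mk _ (x : MvPolynomial (Fin 3) F) = 0 ↔ (x : MvPolynomial (Fin 3) F) ∈ I.toIdeal
    rw [Ideal.Quotient.eq_zero_iff_mem]
  have hrange : LinearMap.range f = formsImage I.toIdeal n := by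
    rw [LinearMap.range_comp, Submodule.range_subtype]
  rw [hilbertFn, ← hker, f.quotKerEquivRange.finrank_eq, hrange]

theorem degree_eq_of_eventually {I : HomIdeal F} {δ : ℕ}
    (h : ∀ᶠ n in Filter.atTop, hilbertFn I n = δ) : degree I = δ := by
  have : {δ' : ℕ | ∀ᶠ n in Filter.atTop, hilbertFn I n = δ'} = {δ} := by
    ext δ'
    refine ⟨fun h' => ?_, fun h' => h' ▸ h⟩
    obtain ⟨n, hn, hn'⟩ := (h.and h').exists
    exact hn'.symm.trans hn
  rw [degree, this, csInf_singleton]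

theorem IsZeroDim.eventually_hilbertFn_eq_degree {I : HomIdeal F} (h : IsZeroDim I) :
    ∀ᶠ n in Filter.atTop, hilbertFn I n = degree I := by
  obtain ⟨δ, hδ⟩ := h
  rwa [degree_eq_of_eventually hδ]

/-- Write `f = j + g * (l - 1)` and compare components modulo `J`: those of `g` vanish below degree
`n`, and the one of degree `n + k` is `-l ^ k * f`. It is zero beyond the total degree of `g`. -/
theorem exists_pow_mul_mem {l : MvPolynomial (Fin 3) F} (hl : l.IsHomogeneous 1) (J : HomIdeal F)
    {n : ℕ} {f : MvPolynomial (Fin 3) F} (hf : f.IsHomogeneous n)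
    (hfJ : f ∈ J.toIdeal ⊔ Ideal.span {l - 1}) : ∃ k, l ^ k * f ∈ J.toIdeal := by
  obtain ⟨j, hj, _, hg, rfl⟩ := Submodule.mem_sup.1 hfJ
  obtain ⟨g, rfl⟩ := Ideal.mem_span_singleton'.1 hg
  set f := j + g * (l - 1) with hfdef
  have hmod : ∀ m, homogeneousComponent m f - (homogeneousComponent m (l * g) -
      homogeneousComponent m g) ∈ J.toIdeal := fun m => by
    have : f - (l * g - g) = j := by rw [hfdef]; ring
    rw [← map_sub, ← map_sub, this]
    exact component_mem J hj m
  have hlow : ∀ m < n, homogeneousComponent m g ∈ J.toIdeal := by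
    intro m
    induction m with
    | zero =>
      intro hm
      have := hmod 0
      rwa [homogeneousComponent_of_mem hf, if_neg hm.ne, homogeneousComponent_zero_mul hl, zero_sub,
        zero_sub, neg_neg] at this
    | succ m ih =>
      intro hm
      have := hmod (m + 1)
      rw [homogeneousComponent_of_mem hf, if_neg hm.ne, homogeneousComponent_succ_mul hl] at this
      have h2 := J.toIdeal.mul_mem_left l (ih (by lia))
      convert add_mem this h2 using 1
      ring
  have hn : homogeneousComponent n g + f ∈ J.toIdeal := by
    have := hmod n
    rw [homogeneousComponent_of_mem hf, if_pos rfl] at this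
    obtain _ | n := n
    · rw [homogeneousComponent_zero_mul hl] at this
      convert this using 1
      ring
    · rw [homogeneousComponent_succ_mul hl] at this
      convert add_mem this (J.toIdeal.mul_mem_left l (hlow n (by lia))) using 1
      ring
  have hup : ∀ k, homogeneousComponent (n + k) g + l ^ k * f ∈ J.toIdeal := by
    intro k
    induction k with
    | zero => simpa using hn
    | succ k ih =>
      have := hmod (n + k + 1)
      rw [homogeneousComponent_of_mem hf, if_neg (by lia), homogeneousComponent_succ_mul hl] at this
      convert add_mem this (J.toIdeal.mul_mem_left l ih) using 1
      rw [← add_assoc]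
      ring
  refine ⟨g.totalDegree + 1, ?_⟩
  have := hup (g.totalDegree + 1)
  rwa [homogeneousComponent_eq_zero _ _ (by lia), zero_add] at this

/-- If the form `l` is a nonzerodivisor modulo `I`, dehomogenizing at `l` loses nothing. -/
theorem mem_of_mem_sup_span_sub_one {l : MvPolynomial (Fin 3) F} (hl : l.IsHomogeneous 1)
    {I : HomIdeal F} (hnzd : ∀ f, l * f ∈ I.toIdeal → f ∈ I.toIdeal) {n : ℕ}
    {f : MvPolynomial (Fin 3) F} (hf : f.IsHomogeneous n)
    (hfI : f ∈ I.toIdeal ⊔ Ideal.span {l - 1}) : f ∈ I.toIdeal := by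
  obtain ⟨k, hk⟩ := exists_pow_mul_mem hl I hf hfI
  induction k with
  | zero => simpa using hk
  | succ k ih => exact ih (hnzd _ (by rwa [← mul_assoc, ← pow_succ']))

theorem map_mulLeft_formsImage_le {l : MvPolynomial (Fin 3) F} (hl : l.IsHomogeneous 1)
    (J : Ideal (MvPolynomial (Fin 3) F)) (n : ℕ) :
    (formsImage J n).map (LinearMap.mulLeft F (Ideal.Quotient.mk J l)) ≤ formsImage J (n + 1) := by
  rintro _ ⟨_, ⟨f, hf, rfl⟩, rfl⟩
  exact ⟨l * f, add_comm 1 n ▸ hl.mul hf, map_mul (Ideal.Quotient.mk J) l f⟩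

/-- Every form of sufficiently large degree is divisible by `l` modulo `J`: the subscheme defined by
`J` does not meet the line `l = 0`. -/
def IsDisjointFrom (J : Ideal (MvPolynomial (Fin 3) F)) (l : MvPolynomial (Fin 3) F) : Prop :=
  ∀ᶠ n in Filter.atTop, ∀ f : MvPolynomial (Fin 3) F, f.IsHomogeneous (n + 1) →
    ∃ g : MvPolynomial (Fin 3) F, g.IsHomogeneous n ∧ f - l * g ∈ J

theorem IsDisjointFrom.mono {J J' : Ideal (MvPolynomial (Fin 3) F)} {l : MvPolynomial (Fin 3) F}
    (h : IsDisjointFrom J l) (hJ : J ≤ J') : IsDisjointFrom J' l := by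
  filter_upwards [h] with n hn f hf
  obtain ⟨g, hg, hfg⟩ := hn f hf
  exact ⟨g, hg, hJ hfg⟩

/-- In large degrees multiplication by `l` is injective between spaces of equal dimension, hence
surjective. -/
theorem IsZeroDim.isDisjointFrom {I : HomIdeal F} (hI : IsZeroDim I) {l : MvPolynomial (Fin 3) F}
    (hl : l.IsHomogeneous 1) (hnzd : ∀ f, l * f ∈ I.toIdeal → f ∈ I.toIdeal) :
    IsDisjointFrom I.toIdeal l := by
  have h0 := hI.eventually_hilbertFn_eq_degree
  have h1 := (Filter.tendsto_add_atTop_nat 1).eventually h0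
  filter_upwards [h0, h1] with n hn hn1 f hf
  have hinj : Function.Injective (LinearMap.mulLeft F (Ideal.Quotient.mk I.toIdeal l)) := by
    rw [injective_iff_map_eq_zero]
    intro x hx
    obtain ⟨g, rfl⟩ := Ideal.Quotient.mk_surjective x
    rw [LinearMap.mulLeft_apply, ← map_mul, Ideal.Quotient.eq_zero_iff_mem] at hx
    exact Ideal.Quotient.eq_zero_iff_mem.2 (hnzd g hx)
  have heq := Submodule.eq_of_le_of_finrank_le (map_mulLeft_formsImage_le hl I.toIdeal n) (by
    rw [← (Submodule.equivMapOfInjective _ hinj (formsImage I.toIdeal n)).finrank_eq,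
      ← hilbertFn_eq_finrank_formsImage, ← hilbertFn_eq_finrank_formsImage, hn, hn1])
  have hfm : Ideal.Quotient.mk I.toIdeal f ∈ formsImage I.toIdeal (n + 1) := ⟨f, hf, rfl⟩
  rw [← heq] at hfm
  obtain ⟨_, ⟨g, hg, rfl⟩, hfg⟩ := hfm
  refine ⟨g, hg, ?_⟩
  rw [← Ideal.Quotient.eq_zero_iff_mem, map_sub, map_mul, sub_eq_zero]
  exact hfg.symm

theorem exists_forall_ge_eq_of_antitone_from (h : ℕ → ℕ) (n₀ : ℕ)
    (hh : ∀ n ≥ n₀, h (n + 1) ≤ h n) : ∃ n₁ ≥ n₀, ∀ n ≥ n₁, h n = h n₁ := by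
  let f : ℕ → ℕ := fun n => h (n₀ + n)
  have hf : Antitone f := antitone_nat_of_succ_le fun n => hh _ (by lia)
  refine ⟨n₀ + Function.argmin f, by lia, fun n hn => ?_⟩
  obtain ⟨k, rfl⟩ := Nat.exists_eq_add_of_le hn
  refine le_antisymm ?_ ?_
  · have := hf (show Function.argmin f ≤ Function.argmin f + k by lia)
    simpa [f, add_assoc] using this
  · have := Function.argmin_le f (Function.argmin f + k)
    simpa [f, add_assoc] using this

/-- The degree of a subscheme disjoint from the line `l = 0` is the dimension of its affine
coordinate ring in the complement of that line. -/
theorem IsDisjointFrom.degree_eq {J : HomIdeal F} {l : MvPolynomial (Fin 3) F}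
    (hl : l.IsHomogeneous 1) (h : IsDisjointFrom J.toIdeal l) :
    FiniteDimensional F (MvPolynomial (Fin 3) F ⧸ (J.toIdeal ⊔ Ideal.span {l - 1})) ∧
    degree J = finrank F (MvPolynomial (Fin 3) F ⧸ (J.toIdeal ⊔ Ideal.span {l - 1})) := by
  obtain ⟨n₀, hn₀⟩ := Filter.eventually_atTop.1 h
  have hmap : ∀ n ≥ n₀, (formsImage J.toIdeal n).map
      (LinearMap.mulLeft F (Ideal.Quotient.mk J.toIdeal l)) = formsImage J.toIdeal (n + 1) := by
    intro n hn
    refine le_antisymm (map_mulLeft_formsImage_le hl _ n) ?_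
    rintro _ ⟨f, hf, rfl⟩
    obtain ⟨g, hg, hfg⟩ := hn₀ n hn f hf
    refine ⟨_, ⟨g, hg, rfl⟩, ?_⟩
    rw [← Ideal.Quotient.eq_zero_iff_mem, map_sub, map_mul, sub_eq_zero] at hfg
    exact hfg.symm
  -- Surjectivity of multiplication by `l` makes the Hilbert function eventually nonincreasing,
  -- hence constant, hence multiplication by `l` injective. Saturation plays no role, so the result
  -- applies to sums such as `inter E L.ideal`.
  obtain ⟨n₁, hn₁, hconst⟩ := exists_forall_ge_eq_of_antitone_from (hilbertFn J) n₀ (by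
    intro n hn
    rw [hilbertFn_eq_finrank_formsImage, hilbertFn_eq_finrank_formsImage, ← hmap n hn]
    exact Submodule.finrank_map_le _ _)
  have hinj : ∀ n ≥ n₁, ∀ f : MvPolynomial (Fin 3) F, f.IsHomogeneous n → l * f ∈ J.toIdeal →
      f ∈ J.toIdeal := by
    intro n hn f hf hlf
    let φ := (LinearMap.mulLeft F (Ideal.Quotient.mk J.toIdeal l)).domRestrict
      (formsImage J.toIdeal n)
    have h1 := φ.finrank_range_add_finrank_ker
    rw [LinearMap.range_domRestrict, hmap n (by lia), ← hilbertFn_eq_finrank_formsImage,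
      ← hilbertFn_eq_finrank_formsImage, hconst n hn, hconst (n + 1) (by lia)] at h1
    have h2 : LinearMap.ker φ = ⊥ := Submodule.finrank_eq_zero.1 (Nat.add_eq_left.1 h1)
    have h3 : (⟨Ideal.Quotient.mk J.toIdeal f, ⟨f, hf, rfl⟩⟩ : formsImage J.toIdeal n) = 0 := by
      rw [← Submodule.mem_bot F, ← h2, LinearMap.mem_ker]
      change Ideal.Quotient.mk J.toIdeal l * Ideal.Quotient.mk J.toIdeal f = 0
      rwa [← map_mul, Ideal.Quotient.eq_zero_iff_mem]
    exact Ideal.Quotient.eq_zero_iff_mem.1 (congrArg Subtype.val h3)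
  have hpow : ∀ k, ∀ n ≥ n₁, ∀ f : MvPolynomial (Fin 3) F, f.IsHomogeneous n →
      l ^ k * f ∈ J.toIdeal → f ∈ J.toIdeal := by
    intro k
    induction k with
    | zero => simp
    | succ k ih =>
      intro n hn f hf hk
      refine hinj n hn f hf (ih (1 + n) (by lia) _ (hl.mul hf) ?_)
      rwa [← mul_assoc, ← pow_succ]
  have hmem : ∀ k, ∀ f : MvPolynomial (Fin 3) F, f.IsHomogeneous (n₁ + k) →
      ∃ g : MvPolynomial (Fin 3) F, g.IsHomogeneous n₁ ∧
        f - g ∈ J.toIdeal ⊔ Ideal.span {l - 1} := by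
    intro k
    induction k with
    | zero => exact fun f hf => ⟨f, hf, by simp⟩
    | succ k ih =>
      intro f hf
      obtain ⟨g, hg, hfg⟩ := hn₀ (n₁ + k) (by lia) f hf
      obtain ⟨g', hg', hgg'⟩ := ih g hg
      refine ⟨g', hg', ?_⟩
      have h1 := Ideal.mem_sup_left (T := Ideal.span {l - 1}) hfg
      have h2 : (l - 1) * g ∈ J.toIdeal ⊔ Ideal.span {l - 1} :=
        Ideal.mul_mem_right _ _ (Ideal.mem_sup_right (Ideal.mem_span_singleton_self _))
      convert add_mem (add_mem h1 h2) hgg' using 1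
      ring
  -- Forms of the single degree `n₁` already represent the whole affine ring, because `l` becomes 1.
  let ψ := (Ideal.Quotient.mkₐ F (J.toIdeal ⊔ Ideal.span {l - 1})).toLinearMap ∘ₗ
    (homogeneousSubmodule (Fin 3) F n₁).subtype
  have hrange : LinearMap.range ψ = ⊤ := by
    refine eq_top_iff.2 fun x _ => ?_
    obtain ⟨f, rfl⟩ := Ideal.Quotient.mk_surjective x
    rw [← sum_homogeneousComponent f, map_sum]
    refine Submodule.sum_mem _ fun i _ => ?_
    obtain hi | hi := le_total n₁ i
    · obtain ⟨k, rfl⟩ := Nat.exists_eq_add_of_le hi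
      obtain ⟨g, hg, hfg⟩ := hmem k _ (homogeneousComponent_isHomogeneous _ f)
      exact ⟨⟨g, hg⟩, (Ideal.Quotient.eq.2 hfg).symm⟩
    · refine ⟨⟨l ^ (n₁ - i) * homogeneousComponent i f, ?_⟩, ?_⟩
      · have := (hl.pow (n₁ - i)).mul (homogeneousComponent_isHomogeneous i f)
        rwa [show 1 * (n₁ - i) + i = n₁ by lia] at this
      · change Ideal.Quotient.mk _ _ = _
        have h1 : Ideal.Quotient.mk (J.toIdeal ⊔ Ideal.span {l - 1}) l = 1 :=
          Ideal.Quotient.eq.2 (Ideal.mem_sup_right (Ideal.mem_span_singleton_self _))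
        dsimp only [Submodule.subtype_apply]
        rw [map_mul, map_pow, h1, one_pow, one_mul]
  have hker : LinearMap.ker ψ = gradedPart J n₁ := by
    ext x
    change Ideal.Quotient.mk _ (x : MvPolynomial (Fin 3) F) = 0 ↔ (x : MvPolynomial (Fin 3) F) ∈ J.toIdeal
    rw [Ideal.Quotient.eq_zero_iff_mem]
    refine ⟨fun hx => ?_, fun hx => Ideal.mem_sup_left hx⟩
    obtain ⟨k, hk⟩ := exists_pow_mul_mem hl J x.2 hx
    exact hpow k n₁ le_rfl _ x.2 hk
  have hfin : FiniteDimensional F (MvPolynomial (Fin 3) F ⧸ (J.toIdeal ⊔ Ideal.span {l - 1})) :=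
    Module.Finite.of_surjective ψ (LinearMap.range_eq_top.1 hrange)
  refine ⟨hfin, ?_⟩
  rw [degree_eq_of_eventually (δ := hilbertFn J n₁) (Filter.eventually_atTop.2 ⟨n₁, hconst⟩),
    hilbertFn, ← hker, ψ.quotKerEquivRange.finrank_eq, hrange, finrank_top]

end Graded

/-! ### A line missing the scheme, and adding reduced points -/

section Points

open MvPolynomial

variable {F : Type*} [Field F]

/-- The curve equation puts `y ^ q` in `(x, z)` modulo `I`: the base point `(0 : 1 : 0)` of the
pencil is not on `Y`. -/
theorem IsSaturated.mem_of_X_zero_mul_mem {I : HomIdeal F} (hI : IsSaturated I) {q m : ℕ}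
    (hq : 2 ≤ q) (hm : 1 ≤ m) (hY : curveForm F q m ∈ I) {x : MvPolynomial (Fin 3) F}
    (h0 : X 0 * x ∈ I.toIdeal) (h2 : X 2 * x ∈ I.toIdeal) : x ∈ I.toIdeal := by
  have hpow : X 1 ^ q * x ∈ I.toIdeal := by
    obtain ⟨q, rfl⟩ := Nat.exists_eq_add_of_le hq
    obtain ⟨m, rfl⟩ := Nat.exists_eq_add_of_le hm
    have h := I.toIdeal.mul_mem_right x hY
    have h0' := I.toIdeal.mul_mem_left (X 0 ^ m * X 2 ^ (2 + q - (1 + m))) h0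
    have h2' := I.toIdeal.mul_mem_left (X 1 * X 2 ^ q) h2
    convert add_mem (sub_mem h h2') h0' using 1
    rw [curveForm, show 2 + q - 1 = q + 1 by lia]
    ring
  generalize q = k at hpow
  induction k with
  | zero => simpa using hpow
  | succ k ih =>
    refine ih (hI _ fun i => ?_)
    match i with
    | 0 =>
      rw [mul_left_comm]
      exact I.toIdeal.mul_mem_left _ h0
    | 1 => rwa [← mul_assoc, ← pow_succ']
    | 2 =>
      rw [mul_left_comm]
      exact I.toIdeal.mul_mem_left _ h2

theorem isHomogeneous_pencil (t : F) :
    (X 0 + C t * X 2 : MvPolynomial (Fin 3) F).IsHomogeneous 1 :=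
  (isHomogeneous_X F 0).add (isHomogeneous_C_mul_X t 2)

/-- This is the independence of eigenvectors for distinct eigenvalues: multiplying by `x + a z`
removes the term of `a` and turns every other `x t` into `(a - t) z` times itself. -/
theorem mem_of_sum_mem_of_pencil_mul_mem {I : HomIdeal F}
    (hI : ∀ x : MvPolynomial (Fin 3) F, X 0 * x ∈ I.toIdeal → X 2 * x ∈ I.toIdeal → x ∈ I.toIdeal)
    (s : Finset F) : ∀ x : F → MvPolynomial (Fin 3) F,
      (∀ t ∈ s, (X 0 + C t * X 2) * x t ∈ I.toIdeal) → ∑ t ∈ s, x t ∈ I.toIdeal →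
      ∀ t ∈ s, x t ∈ I.toIdeal := by
  classical
  induction s using Finset.induction_on with
  | empty => simp
  | insert a s ha ih =>
    intro x hx hsum
    have hs : ∀ t ∈ s, x t ∈ I.toIdeal := by
      intro t ht
      have hta : t - a ≠ 0 := sub_ne_zero.2 fun h => ha (h ▸ ht)
      have h2 : X 2 * x t ∈ I.toIdeal := by
        have := ih (fun t => C (t - a) * (X 2 * x t)) (fun t ht => ?_) ?_ t ht
        · have := I.toIdeal.mul_mem_left (C (t - a)⁻¹) this
          rwa [← mul_assoc, ← C_mul, inv_mul_cancel₀ hta, C_1, one_mul] at this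
        · have := I.toIdeal.mul_mem_left (C (t - a) * X 2) (hx t (Finset.mem_insert_of_mem ht))
          convert this using 1
          ring
        · have h1 := I.toIdeal.mul_mem_left (X 0 + C a * X 2) hsum
          have h3 : ∑ t ∈ insert a s, (X 0 + C t * X 2) * x t ∈ I.toIdeal :=
            I.toIdeal.sum_mem hx
          convert sub_mem h3 h1 using 1
          rw [Finset.mul_sum, ← Finset.sum_sub_distrib, Finset.sum_insert ha, sub_self, zero_add]
          refine Finset.sum_congr rfl fun t _ => ?_
          rw [C_sub]
          ring
      refine hI _ ?_ h2
      convert sub_mem (hx t (Finset.mem_insert_of_mem ht)) (I.toIdeal.mul_mem_left (C t) h2) using 1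
      ring
    intro t ht
    obtain rfl | ht := Finset.mem_insert.1 ht
    · rw [Finset.sum_insert ha] at hsum
      convert sub_mem hsum (I.toIdeal.sum_mem hs) using 1
      ring
    · exact hs t ht

/-- A pencil of lines whose base point is not on the zero-dimensional subscheme contains a line
disjoint from the subscheme, if the field has more elements than the degree. -/
theorem exists_pencil_nonzerodivisor [Fintype F] {I : HomIdeal F} (hsat : IsSaturated I)
    (hdim : IsZeroDim I) (hdeg : degree I < Fintype.card F)
    (hI : ∀ x : MvPolynomial (Fin 3) F, X 0 * x ∈ I.toIdeal → X 2 * x ∈ I.toIdeal → x ∈ I.toIdeal) :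
    ∃ t : F, ∀ f, (X 0 + C t * X 2) * f ∈ I.toIdeal → f ∈ I.toIdeal := by
  by_contra! hbad
  have hhom : ∀ t : F, ∃ n, ∃ f : MvPolynomial (Fin 3) F, f.IsHomogeneous n ∧
      (X 0 + C t * X 2) * f ∈ I.toIdeal ∧ f ∉ I.toIdeal := by
    intro t
    obtain ⟨f, hf, hfI⟩ := hbad t
    rw [mem_iff_component_mem] at hfI
    push Not at hfI
    obtain ⟨n, hn⟩ := hfI
    refine ⟨n, _, homogeneousComponent_isHomogeneous n f, ?_, hn⟩
    rw [← homogeneousComponent_succ_mul (isHomogeneous_pencil t)]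
    exact component_mem I hf _
  -- Saturation lifts each witness to all higher degrees, so one degree serves every `t`. The
  -- witnesses are independent there, which forces `degree I` to be at least the number of elements
  -- of `F`.
  have hev : ∀ t : F, ∀ᶠ n in Filter.atTop, ∃ f : MvPolynomial (Fin 3) F, f.IsHomogeneous n ∧
      (X 0 + C t * X 2) * f ∈ I.toIdeal ∧ f ∉ I.toIdeal := by
    intro t
    obtain ⟨n₀, h₀⟩ := hhom t
    refine Filter.eventually_atTop.2 ⟨n₀, fun n hn => ?_⟩
    induction n, hn using Nat.le_induction with
    | base => exact h₀
    | succ n hn ih =>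
      obtain ⟨f, hf, hfI, hf'⟩ := ih
      obtain ⟨i, hi⟩ : ∃ i, X i * f ∉ I.toIdeal := by
        by_contra! h
        exact hf' (hsat f h)
      refine ⟨X i * f, add_comm 1 n ▸ (isHomogeneous_X F i).mul hf, ?_, hi⟩
      rw [mul_left_comm]
      exact I.toIdeal.mul_mem_left _ hfI
  obtain ⟨n, hn, hdn⟩ := ((Filter.eventually_all.2 hev).and
    hdim.eventually_hilbertFn_eq_degree).exists
  choose x hx hxI hx' using hn
  have hli : LinearIndependent F fun t : F =>
      (⟨Ideal.Quotient.mk I.toIdeal (x t), ⟨x t, hx t, rfl⟩⟩ : formsImage I.toIdeal n) := by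
    rw [Fintype.linearIndependent_iff]
    intro g hg t
    by_contra hgt
    have hsum : ∑ t, C (g t) * x t ∈ I.toIdeal := by
      rw [← Ideal.Quotient.eq_zero_iff_mem, map_sum]
      have := congrArg Subtype.val hg
      rw [Submodule.coe_sum] at this
      refine Eq.trans (Finset.sum_congr rfl fun t _ => ?_) this
      rw [← smul_eq_C_mul]
      rfl
    have := mem_of_sum_mem_of_pencil_mul_mem hI Finset.univ (fun t => C (g t) * x t)
      (fun t _ => by
        rw [mul_left_comm]
        exact I.toIdeal.mul_mem_left _ (hxI t)) hsum t (Finset.mem_univ t)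
    refine hx' t ?_
    have := I.toIdeal.mul_mem_left (C (g t)⁻¹) this
    rwa [← mul_assoc, ← C_mul, inv_mul_cancel₀ hgt, C_1, one_mul] at this
  have := hli.fintype_card_le_finrank
  rw [← hilbertFn_eq_finrank_formsImage, hdn] at this
  lia

theorem eval_smul_of_isHomogeneous {f : MvPolynomial (Fin 3) F} {n : ℕ} (hf : f.IsHomogeneous n)
    (a : F) (v : Fin 3 → F) : eval (a • v) f = a ^ n * eval v f := by
  rw [eval_eq', eval_eq', Finset.mul_sum]
  refine Finset.sum_congr rfl fun s hs => ?_
  rw [← hf (mem_support_iff.1 hs), Finsupp.weight_apply, Finsupp.sum_fintype _ _ (by simp)]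
  simp only [Pi.smul_apply, smul_eq_mul, mul_pow, Finset.prod_mul_distrib, Finset.prod_pow_eq_pow_sum,
    Pi.one_apply, mul_one]
  ring

/-- Vanishing is tested on components because, for an inhomogeneous polynomial, it depends on the
representative of the point. -/
theorem mem_pointsIdeal {S : Set (Plane F)} {f : MvPolynomial (Fin 3) F} :
    f ∈ (pointsIdeal S).toIdeal ↔ ∀ n, ∀ P ∈ S, VanishesAt (homogeneousComponent n f) P := by
  have hle : ∀ P ∈ S, ∀ g ∈ (pointsIdeal S).toIdeal, VanishesAt g P := by
    intro P hP g hg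
    have : (pointsIdeal S).toIdeal ≤ RingHom.ker (eval P.rep) := by
      refine Ideal.span_le.2 ?_
      rintro g ⟨n, -, hg⟩
      exact hg P hP
    exact this hg
  refine ⟨fun hf n P hP => hle P hP _ (component_mem _ hf n), fun hf => ?_⟩
  rw [mem_iff_component_mem]
  exact fun n => Ideal.subset_span ⟨n, homogeneousComponent_isHomogeneous n f, hf n⟩

theorem mem_pointsIdeal_of_isHomogeneous {S : Set (Plane F)} {f : MvPolynomial (Fin 3) F} {n : ℕ}
    (hf : f.IsHomogeneous n) :
    f ∈ (pointsIdeal S).toIdeal ↔ ∀ P ∈ S, VanishesAt f P := by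
  refine ⟨fun h P hP => ?_, fun h => Ideal.subset_span ⟨n, hf, h⟩⟩
  have := mem_pointsIdeal.1 h n P hP
  rwa [homogeneousComponent_eq_self hf] at this

theorem exists_rep_ne_zero (P : Plane F) : ∃ i, P.rep i ≠ 0 :=
  Function.ne_iff.1 P.rep_nonzero

theorem isSaturated_union_pointsIdeal {E : HomIdeal F} (hE : IsSaturated E) (S : Set (Plane F)) :
    IsSaturated (union E (pointsIdeal S)) := by
  intro f hf
  refine ⟨hE f fun i => (hf i).1, mem_pointsIdeal.2 fun n P hP => ?_⟩
  obtain ⟨i, hi⟩ := exists_rep_ne_zero P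
  have := mem_pointsIdeal.1 (hf i).2 (n + 1) P hP
  rw [homogeneousComponent_succ_mul (isHomogeneous_X F i), VanishesAt, map_mul, eval_X,
    mul_eq_zero] at this
  exact this.resolve_left hi

theorem exists_linear_form_separating {P P' : Plane F} (h : P' ≠ P) :
    ∃ l : MvPolynomial (Fin 3) F, l.IsHomogeneous 1 ∧ ¬ VanishesAt l P ∧ VanishesAt l P' := by
  have hP : P.rep ∉ Submodule.span F {P'.rep} := by
    intro hmem
    obtain ⟨a, ha⟩ := Submodule.mem_span_singleton.1 hmem
    refine h ?_
    rw [← P.mk_rep, ← P'.mk_rep]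
    exact ((Projectivization.mk_eq_mk_iff' F _ _ P.rep_nonzero P'.rep_nonzero).2 ⟨a, ha⟩).symm
  obtain ⟨φ, hφ, hφ'⟩ := Submodule.exists_le_ker_of_notMem hP
  have heval : ∀ v : Fin 3 → F, eval v (∑ i, C (φ (Pi.single i 1)) * X i) = φ v := by
    intro v
    conv_rhs => rw [← Finset.univ_sum_single v, map_sum]
    rw [map_sum]
    refine Finset.sum_congr rfl fun i _ => ?_
    rw [map_mul, eval_C, eval_X, mul_comm, ← smul_eq_mul, ← map_smul, ← Pi.single_smul, smul_eq_mul,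
      mul_one]
  refine ⟨∑ i, C (φ (Pi.single i 1)) * X i,
    IsHomogeneous.sum _ _ _ fun i _ => isHomogeneous_C_mul_X _ i, ?_, ?_⟩
  · rwa [VanishesAt, heval]
  · rw [VanishesAt, heval]
    exact hφ' (Submodule.mem_span_singleton_self _)

/-- Multiply a form of `E` that is nonzero at `P` by lines through the other points missing `P`,
then pad the degree with a coordinate nonzero at `P`. -/
theorem eventually_exists_separating {E : HomIdeal F} {S : Set (Plane F)} (hS : S.Finite)
    (hES : Disjoint S (redPoints E)) :
    ∀ᶠ n in Filter.atTop, ∀ P ∈ S, ∃ f ∈ E.toIdeal, f.IsHomogeneous n ∧ ¬ VanishesAt f P ∧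
      ∀ P' ∈ S, P' ≠ P → VanishesAt f P' := by
  classical
  refine (Filter.eventually_all_finite hS).2 fun P hP => ?_
  obtain ⟨k, f, hfE, hf, hfP⟩ : ∃ k, ∃ f ∈ E.toIdeal, f.IsHomogeneous k ∧ ¬ VanishesAt f P := by
    have hP' : P ∉ redPoints E := fun h => Set.disjoint_left.1 hES hP h
    by_contra! h
    refine hP' fun f hf => ?_
    rw [VanishesAt, ← sum_homogeneousComponent f, map_sum]
    exact Finset.sum_eq_zero fun i _ =>
      h i _ (component_mem E hf i) (homogeneousComponent_isHomogeneous i f)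
  have hsep : ∀ P' : Plane F, ∃ l : MvPolynomial (Fin 3) F, P' ≠ P →
      l.IsHomogeneous 1 ∧ ¬ VanishesAt l P ∧ VanishesAt l P' := by
    intro P'
    by_cases h : P' = P
    · exact ⟨0, fun h' => (h' h).elim⟩
    · obtain ⟨l, hl⟩ := exists_linear_form_separating h
      exact ⟨l, fun _ => hl⟩
  choose l hl using hsep
  obtain ⟨i, hi⟩ := exists_rep_ne_zero P
  let T := hS.toFinset.erase P
  have hT : ∀ P' ∈ T, P' ≠ P := fun P' h => Finset.ne_of_mem_erase h
  have hprod : (∏ P' ∈ T, l P').IsHomogeneous T.card := by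
    have := IsHomogeneous.prod T l (fun _ => 1) fun P' h => (hl P' (hT P' h)).1
    simpa using this
  refine Filter.eventually_atTop.2 ⟨k + T.card, fun n hn => ?_⟩
  obtain ⟨r, rfl⟩ := Nat.exists_eq_add_of_le hn
  refine ⟨f * (∏ P' ∈ T, l P') * X i ^ r, ?_, (hf.mul hprod).mul (isHomogeneous_X_pow i r), ?_, ?_⟩
  · exact Ideal.mul_mem_right _ _ (Ideal.mul_mem_right _ _ hfE)
  · rw [VanishesAt, map_mul, map_mul, map_prod, map_pow, eval_X]
    exact mul_ne_zero (mul_ne_zero hfP (Finset.prod_ne_zero_iff.2 fun P' h => (hl P' (hT P' h)).2.1))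
      (pow_ne_zero _ hi)
  · intro P' hP' hne
    have hP'T : P' ∈ T := Finset.mem_erase.2 ⟨hne, hS.mem_toFinset.2 hP'⟩
    have hzero : eval P'.rep (l P') = 0 := (hl P' hne).2.2
    rw [VanishesAt, map_mul, map_mul, map_prod, Finset.prod_eq_zero hP'T hzero, mul_zero, zero_mul]

/-- Separating forms make evaluation at `S` surjective on the degree-`n` part of `E`; its kernel is
the degree-`n` part of the union. -/
theorem eventually_hilbertFn_union {E : HomIdeal F} {S : Set (Plane F)} (hS : S.Finite)
    (hES : Disjoint S (redPoints E)) :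
    ∀ᶠ n in Filter.atTop,
      hilbertFn (union E (pointsIdeal S)) n = hilbertFn E n + S.ncard := by
  classical
  filter_upwards [eventually_exists_separating hS hES] with n hn
  have : Fintype S := hS.fintype
  let ev : homogeneousSubmodule (Fin 3) F n →ₗ[F] (S → F) :=
    LinearMap.pi fun P => (aeval P.1.rep : MvPolynomial (Fin 3) F →ₐ[F] F).toLinearMap ∘ₗ
      (homogeneousSubmodule (Fin 3) F n).subtype
  have hev : ∀ f P, ev f P = eval P.1.rep (f : MvPolynomial (Fin 3) F) := fun f P => by
    rw [← coe_aeval_eq_eval]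
    rfl
  let φ := ev.domRestrict (gradedPart E n)
  have hker : (LinearMap.ker φ).map (gradedPart E n).subtype =
      gradedPart (union E (pointsIdeal S)) n := by
    ext f
    have hmem : f ∈ gradedPart (union E (pointsIdeal S)) n ↔
      (f : MvPolynomial (Fin 3) F) ∈ E.toIdeal ∧
        (f : MvPolynomial (Fin 3) F) ∈ (pointsIdeal S).toIdeal := Iff.rfl
    rw [hmem, mem_pointsIdeal_of_isHomogeneous f.2]
    constructor
    · rintro ⟨g, hg, rfl⟩
      have hg' : ev g.1 = 0 := LinearMap.mem_ker.1 hg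
      refine ⟨g.2, fun P hP => ?_⟩
      rw [VanishesAt, Submodule.subtype_apply, ← hev g.1 ⟨P, hP⟩, hg', Pi.zero_apply]
    · rintro ⟨h1, h2⟩
      refine ⟨⟨f, h1⟩, LinearMap.mem_ker.2 (funext fun P => ?_), rfl⟩
      rw [LinearMap.domRestrict_apply, hev]
      exact h2 P P.2
  have hrange : LinearMap.range φ = ⊤ := by
    refine eq_top_iff.2 fun v _ => ?_
    rw [← Finset.univ_sum_single v]
    refine Submodule.sum_mem _ fun P _ => ?_
    obtain ⟨f, hfE, hf, hfP, hfS⟩ := hn P P.2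
    refine ⟨(v P / eval P.1.rep f) • ⟨⟨f, hf⟩, hfE⟩, funext fun P' => ?_⟩
    rw [map_smul, Pi.smul_apply, smul_eq_mul]
    change _ * ev ⟨f, hf⟩ P' = _
    rw [hev]
    obtain rfl | hne := eq_or_ne P' P
    · rw [Pi.single_eq_same]
      exact div_mul_cancel₀ _ hfP
    · rw [Pi.single_eq_of_ne hne]
      exact mul_eq_zero_of_right _ (hfS P' P'.2 fun h => hne (Subtype.ext h))
  have h1 := LinearMap.finrank_range_add_finrank_ker (K := F) (V := gradedPart E n) (V₂ := S → F) φ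
  have h2 := (Submodule.equivSubtypeMap (gradedPart E n) (LinearMap.ker φ)).finrank_eq
  have h3 := (gradedPart E n).finrank_quotient_add_finrank
  have h4 := (gradedPart (union E (pointsIdeal S)) n).finrank_quotient_add_finrank
  rw [hrange, finrank_top, finrank_fintype_fun_eq_card] at h1
  rw [hker] at h2
  have h5 : S.ncard = Fintype.card S := by rw [← Nat.card_coe_set_eq, Nat.card_eq_fintype_card]
  rw [hilbertFn, hilbertFn, h5]
  omega

theorem isZeroDim_union_pointsIdeal {E : HomIdeal F} (hE : IsZeroDim E) {S : Set (Plane F)}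
    (hS : S.Finite) (hES : Disjoint S (redPoints E)) : IsZeroDim (union E (pointsIdeal S)) := by
  obtain ⟨δ, hδ⟩ := hE
  refine ⟨δ + S.ncard, ?_⟩
  filter_upwards [hδ, eventually_hilbertFn_union hS hES] with n h1 h2
  rw [h2, h1]

end Points

/-! ### Relations among points and lines, in the affine chart -/

section Affine

open MvPolynomial

variable {F : Type*} [Field F] {l : MvPolynomial (Fin 3) F} {J : Ideal (MvPolynomial (Fin 3) F)}

theorem formsImage_one_pow (J : Ideal (MvPolynomial (Fin 3) F)) (n : ℕ) :
    formsImage J 1 ^ n = formsImage J n := by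
  rw [formsImage, ← Submodule.map_pow, homogeneousSubmodule_one_pow]

theorem one_mem_formsImage_one (hl : l.IsHomogeneous 1) (hlJ : l - 1 ∈ J) :
    (1 : MvPolynomial (Fin 3) F ⧸ J) ∈ formsImage J 1 :=
  mem_formsImage.2 ⟨l, hl, Ideal.Quotient.eq.2 hlJ⟩

theorem exists_mem_formsImage_one_pow (hl : l.IsHomogeneous 1) (hlJ : l - 1 ∈ J)
    (x : MvPolynomial (Fin 3) F ⧸ J) : ∃ n, x ∈ formsImage J 1 ^ n := by
  obtain ⟨f, rfl⟩ := Ideal.Quotient.mk_surjective x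
  obtain ⟨N, hN⟩ : ∃ N, f.totalDegree = N := ⟨_, rfl⟩
  refine ⟨N, ?_⟩
  rw [← sum_homogeneousComponent f, map_sum, hN]
  refine Submodule.sum_mem _ fun i hi => ?_
  refine pow_mono_of_one_mem (one_mem_formsImage_one hl hlJ) (m := i)
    (by rw [Finset.mem_range] at hi; lia) ?_
  rw [formsImage_one_pow]
  exact mem_formsImage.2 ⟨_, homogeneousComponent_isHomogeneous i f, rfl⟩

theorem finrank_formsImage_one_le (J : Ideal (MvPolynomial (Fin 3) F)) :
    finrank F (formsImage J 1) ≤ 3 :=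
  (Submodule.finrank_map_le _ _).trans finrank_homogeneousSubmodule_one.le

theorem finrank_formsImage_one_le_two_iff :
    finrank F (formsImage J 1) ≤ 2 ↔
      ∃ L : MvPolynomial (Fin 3) F, L.IsHomogeneous 1 ∧ L ≠ 0 ∧ L ∈ J := by
  let φ : homogeneousSubmodule (Fin 3) F 1 →ₗ[F] MvPolynomial (Fin 3) F ⧸ J :=
    (Ideal.Quotient.mkₐ F J).toLinearMap.domRestrict _
  have hφ : ∀ L, φ L = 0 ↔ (L : MvPolynomial (Fin 3) F) ∈ J := fun L =>
    Ideal.Quotient.eq_zero_iff_mem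
  have h := LinearMap.finrank_range_add_finrank_ker (K := F) φ
  rw [LinearMap.range_domRestrict, finrank_homogeneousSubmodule_one] at h
  change finrank F (formsImage J 1) + _ = 3 at h
  have h' : finrank F (formsImage J 1) ≤ 2 ↔ 1 ≤ finrank F (LinearMap.ker φ) := by lia
  rw [h', Submodule.one_le_finrank_iff, Submodule.ne_bot_iff]
  constructor
  · rintro ⟨L, hL, hL0⟩
    exact ⟨L, L.2, fun h => hL0 (Subtype.ext h), (hφ L).1 hL⟩
  · rintro ⟨L, hL, hL0, hLJ⟩
    exact ⟨⟨L, hL⟩, (hφ ⟨L, hL⟩).2 hLJ, fun h => hL0 (congrArg Subtype.val h)⟩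

theorem add_two_le_finrank_quotient (hl : l.IsHomogeneous 1) (hlJ : l - 1 ∈ J)
    [FiniteDimensional F (MvPolynomial (Fin 3) F ⧸ J)] {θ : MvPolynomial (Fin 3) F →ₗ[F] F} {d : ℕ}
    (hθJ : ∀ f ∈ J, θ f = 0) (hθd : ∀ f : MvPolynomial (Fin 3) F, f.IsHomogeneous d → θ f = 0)
    (hθ : θ ≠ 0) : d + 2 ≤ finrank F (MvPolynomial (Fin 3) F ⧸ J) := by
  refine add_two_le_finrank (one_mem_formsImage_one hl hlJ) (exists_mem_formsImage_one_pow hl hlJ)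
    fun htop => hθ (LinearMap.ext fun x => ?_)
  have hx : Ideal.Quotient.mk J x ∈ formsImage J d := by
    rw [← formsImage_one_pow, htop]
    exact Submodule.mem_top
  obtain ⟨f, hf, hfx⟩ := mem_formsImage.1 hx
  have := hθJ _ (Ideal.Quotient.eq.1 hfx)
  rw [map_sub, hθd f hf, zero_sub, neg_eq_zero] at this
  exact this

/-- The largest ideal on which a functional vanishes. -/
def radical (θ : MvPolynomial (Fin 3) F →ₗ[F] F) : Ideal (MvPolynomial (Fin 3) F) where
  carrier := {x | ∀ y, θ (x * y) = 0}
  add_mem' := fun ha hb y => by rw [add_mul, map_add, ha y, hb y, add_zero]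
  zero_mem' := fun y => by rw [zero_mul, map_zero]
  smul_mem' := fun c x hx y => by rw [smul_eq_mul, mul_assoc, mul_left_comm]; exact hx (c * y)

theorem exists_linear_form_mul_eq_zero (hl : l.IsHomogeneous 1) (hlJ : l - 1 ∈ J)
    [FiniteDimensional F (MvPolynomial (Fin 3) F ⧸ J)] {θ : MvPolynomial (Fin 3) F →ₗ[F] F} {d : ℕ}
    (hdim : finrank F (MvPolynomial (Fin 3) F ⧸ J) ≤ 2 * d + 1)
    (hθJ : ∀ f ∈ J, θ f = 0) (hθd : ∀ f : MvPolynomial (Fin 3) F, f.IsHomogeneous d → θ f = 0)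
    (hθ : θ ≠ 0) :
    ∃ L : MvPolynomial (Fin 3) F, L.IsHomogeneous 1 ∧ L ≠ 0 ∧ ∀ x, θ (L * x) = 0 := by
  have hJ : J ≤ radical θ := fun x hx y => hθJ _ (J.mul_mem_right y hx)
  have hsurj : Function.Surjective (Ideal.Quotient.factorₐ F hJ).toLinearMap :=
    Ideal.Quotient.factor_surjective hJ
  have : FiniteDimensional F (MvPolynomial (Fin 3) F ⧸ radical θ) :=
    Module.Finite.of_surjective _ hsurj
  have hdim' := LinearMap.finrank_le_finrank_of_surjective hsurj
  have hne : radical θ ≠ ⊤ := fun h => hθ (LinearMap.ext fun x => by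
    have h1 : (1 : MvPolynomial (Fin 3) F) ∈ radical θ := h ▸ Submodule.mem_top
    simpa using h1 x)
  have : Nontrivial (MvPolynomial (Fin 3) F ⧸ radical θ) := Ideal.Quotient.nontrivial_iff.2 hne
  have hle : (radical θ).restrictScalars F ≤ LinearMap.ker θ := fun x hx => by
    have := hx 1
    rwa [mul_one] at this
  let θ' : (MvPolynomial (Fin 3) F ⧸ radical θ) →ₗ[F] F :=
    ((radical θ).restrictScalars F).liftQ θ hle ∘ₗ
      (Submodule.Quotient.restrictScalarsEquiv F (radical θ)).symm.toLinearMap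
  have hθ' : ∀ x, θ' (Ideal.Quotient.mk _ x) = θ x := fun x => rfl
  have h2 : finrank F (formsImage (radical θ) 1) ≤ 2 := by
    refine finrank_le_two_of_nondegenerate d (one_mem_formsImage_one hl (hJ hlJ))
      (exists_mem_formsImage_one_pow hl (hJ hlJ)) (finrank_formsImage_one_le _) (θ := θ') ?_ ?_
      (hdim'.trans hdim)
    · intro x hx
      obtain ⟨f, rfl⟩ := Ideal.Quotient.mk_surjective x
      refine Ideal.Quotient.eq_zero_iff_mem.2 fun y => ?_
      rw [← hθ', map_mul]
      exact hx _
    · intro x hx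
      rw [formsImage_one_pow] at hx
      obtain ⟨f, hf, rfl⟩ := mem_formsImage.1 hx
      rw [hθ']
      exact hθd f hf
  exact finrank_formsImage_one_le_two_iff.1 h2

variable {ι : Type*} (p : ι → Fin 3 → F)

/-- Restriction of polynomials to the subscheme defined by `K` and to the points `p i`. -/
noncomputable def restrictEval (K : Ideal (MvPolynomial (Fin 3) F)) :
    MvPolynomial (Fin 3) F →ₐ[F] (MvPolynomial (Fin 3) F ⧸ K) × (ι → F) :=
  (Ideal.Quotient.mkₐ F K).prod (AlgHom.pi fun i => aeval (p i))

variable {p}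

theorem mem_ker_restrictEval {K : Ideal (MvPolynomial (Fin 3) F)} {f : MvPolynomial (Fin 3) F} :
    f ∈ RingHom.ker (restrictEval p K) ↔ f ∈ K ∧ ∀ i, aeval (p i) f = 0 := by
  rw [RingHom.mem_ker, ← Ideal.Quotient.eq_zero_iff_mem, ← funext_iff (g := fun _ => (0 : F))]
  exact Prod.ext_iff

theorem finite_and_finrank_quotient_ker_restrictEval_le [Fintype ι]
    (K : Ideal (MvPolynomial (Fin 3) F)) [FiniteDimensional F (MvPolynomial (Fin 3) F ⧸ K)] :
    FiniteDimensional F (MvPolynomial (Fin 3) F ⧸ RingHom.ker (restrictEval p K)) ∧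
    finrank F (MvPolynomial (Fin 3) F ⧸ RingHom.ker (restrictEval p K)) ≤
      finrank F (MvPolynomial (Fin 3) F ⧸ K) + Fintype.card ι := by
  have hinj : Function.Injective (Ideal.kerLiftAlg (restrictEval p K)).toLinearMap := by
    rw [AlgHom.coe_toLinearMap]
    exact Ideal.kerLiftAlg_injective (restrictEval p K)
  have hfin : FiniteDimensional F ((MvPolynomial (Fin 3) F ⧸ K) × (ι → F)) := inferInstance
  refine ⟨Module.Finite.of_injective (Ideal.kerLiftAlg (restrictEval p K)).toLinearMap hinj, ?_⟩
  have := LinearMap.finrank_le_finrank_of_injective hinj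
  rwa [finrank_prod, finrank_fintype_fun_eq_card] at this

variable [Fintype ι] {E : Ideal (MvPolynomial (Fin 3) F)}

theorem exists_line_of_relation {Z : Ideal (MvPolynomial (Fin 3) F)} {d : ℕ}
    (hl : l.IsHomogeneous 1) (hlZ : l - 1 ∈ Z) (hZE : Z ≤ E)
    (hZp : ∀ f ∈ Z, ∀ i, aeval (p i) f = 0)
    (hsep : ∀ i, ∃ f ∈ E, aeval (p i) f ≠ 0 ∧ ∀ j ≠ i, aeval (p j) f = 0)
    [FiniteDimensional F (MvPolynomial (Fin 3) F ⧸ Z)]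
    (hdim : finrank F (MvPolynomial (Fin 3) F ⧸ Z) ≤ 2 * d + 1) [Nonempty ι] {v : ι → F}
    (hv : ∀ i, v i ≠ 0)
    (hvE : ∀ f ∈ E, f.IsHomogeneous d → ∑ i, v i * aeval (p i) f = 0) :
    ∃ L : MvPolynomial (Fin 3) F, L.IsHomogeneous 1 ∧ L ≠ 0 ∧ (∀ i, aeval (p i) L = 0) ∧
      d + 2 ≤ finrank F (MvPolynomial (Fin 3) F ⧸ (Z ⊔ Ideal.span {L})) ∧
      d + 2 ≤ finrank F (MvPolynomial (Fin 3) F ⧸ (E ⊔ Ideal.span {L})) + Fintype.card ι := by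
  let ω : MvPolynomial (Fin 3) F →ₗ[F] F :=
    ∑ i, v i • (aeval (p i) : MvPolynomial (Fin 3) F →ₐ[F] F).toLinearMap
  have hω : ∀ f, ω f = ∑ i, v i * aeval (p i) f := fun f => by
    simp [ω, LinearMap.sum_apply]
  obtain ⟨θ, hθd, hθE⟩ : ∃ θ : MvPolynomial (Fin 3) F →ₗ[F] F,
      (∀ f : MvPolynomial (Fin 3) F, f.IsHomogeneous d → θ f = 0) ∧ ∀ f ∈ E, θ f = ω f := by
    -- The relation says that `ω` on `E` kills the kernel of `h`, so it factors through polynomials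
    -- modulo forms of degree `d`.
    let h := (homogeneousSubmodule (Fin 3) F d).mkQ ∘ₗ (E.restrictScalars F).subtype
    have hmem : ω ∘ₗ (E.restrictScalars F).subtype ∈ LinearMap.range h.dualMap := by
      rw [LinearMap.range_dualMap_eq_dualAnnihilator_ker, Submodule.mem_dualAnnihilator]
      intro f hf
      rw [LinearMap.mem_ker, LinearMap.comp_apply, Submodule.mkQ_apply,
        Submodule.Quotient.mk_eq_zero] at hf
      exact (hω f).trans (hvE f f.2 hf)
    obtain ⟨ξ, hξ⟩ := hmem
    refine ⟨ξ ∘ₗ (homogeneousSubmodule (Fin 3) F d).mkQ, fun f hf => ?_, fun f hf => ?_⟩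
    · rw [LinearMap.comp_apply, Submodule.mkQ_apply, (Submodule.Quotient.mk_eq_zero _).2 hf, map_zero]
    · exact LinearMap.congr_fun hξ ⟨f, hf⟩
  have hθsep : ∀ i, ∀ f ∈ E, (∀ j ≠ i, aeval (p j) f = 0) → θ f = v i * aeval (p i) f := by
    intro i f hf hfj
    rw [hθE f hf, hω]
    exact Finset.sum_eq_single i (fun j _ hj => by rw [hfj j hj, mul_zero]) (by simp)
  have hθ0 : θ ≠ 0 := by
    rintro rfl
    obtain ⟨i⟩ := ‹Nonempty ι›
    obtain ⟨f, hf, hfi, hfj⟩ := hsep i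
    exact mul_ne_zero (hv i) hfi (hθsep i f hf hfj).symm
  have hθZ : ∀ f ∈ Z, θ f = 0 := fun f hf => by
    rw [hθE f (hZE hf), hω]
    exact Finset.sum_eq_zero fun i _ => by rw [hZp f hf i, mul_zero]
  obtain ⟨L, hL, hL0, hLθ⟩ := exists_linear_form_mul_eq_zero hl hlZ hdim hθZ hθd hθ0
  -- Evaluating `θ (L * f) = 0` at an `f` separating `p i` isolates the value of `L` there, times
  -- nonzero factors.
  have hLp : ∀ i, aeval (p i) L = 0 := by
    intro i
    obtain ⟨f, hf, hfi, hfj⟩ := hsep i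
    have := hθsep i (L * f) (E.mul_mem_left L hf) fun j hj => by rw [map_mul, hfj j hj, mul_zero]
    rw [hLθ, map_mul] at this
    by_contra h
    exact mul_ne_zero (hv i) (mul_ne_zero h hfi) this.symm
  have hfinite : ∀ K, Z ≤ K → FiniteDimensional F (MvPolynomial (Fin 3) F ⧸ K) := fun K hK =>
    Module.Finite.of_surjective (Ideal.Quotient.factorₐ F hK).toLinearMap
      (Ideal.Quotient.factor_surjective hK)
  refine ⟨L, hL, hL0, hLp, ?_, ?_⟩
  · have := hfinite (Z ⊔ Ideal.span {L}) le_sup_left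
    refine add_two_le_finrank_quotient hl (Ideal.mem_sup_left hlZ) (fun f hf => ?_) hθd hθ0
    obtain ⟨z, hz, _, hx, rfl⟩ := Submodule.mem_sup.1 hf
    obtain ⟨x, rfl⟩ := Ideal.mem_span_singleton'.1 hx
    rw [map_add, hθZ z hz, mul_comm, hLθ, add_zero]
  · have := hfinite (E ⊔ Ideal.span {L}) (hZE.trans le_sup_left)
    -- Embedding in the product of the ring of `E ∩ L` with the point values bounds the dimension by
    -- the two separate contributions.
    obtain ⟨h1, h2⟩ := finite_and_finrank_quotient_ker_restrictEval_le (p := p) (E ⊔ Ideal.span {L})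
    refine le_trans (add_two_le_finrank_quotient hl ?_ (fun f hf => ?_) hθd hθ0) h2
    · exact mem_ker_restrictEval.2 ⟨Ideal.mem_sup_left (hZE hlZ), hZp _ hlZ⟩
    · obtain ⟨hfE, hfp⟩ := mem_ker_restrictEval.1 hf
      obtain ⟨e, he, _, hx, rfl⟩ := Submodule.mem_sup.1 hfE
      obtain ⟨x, rfl⟩ := Ideal.mem_span_singleton'.1 hx
      rw [map_add, mul_comm, hLθ, add_zero, hθE e he, hω]
      refine Finset.sum_eq_zero fun i _ => ?_
      have := hfp i
      rw [map_add, map_mul, hLp, mul_zero, add_zero] at this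
      rw [this, mul_zero]

theorem exists_relation_of_line {d : ℕ} (hl : l.IsHomogeneous 1) (hlE : l - 1 ∈ E)
    (hlp : ∀ i, aeval (p i) l = 1)
    (hsep : ∀ i, ∃ f ∈ E, aeval (p i) f ≠ 0 ∧ ∀ j ≠ i, aeval (p j) f = 0)
    {L : MvPolynomial (Fin 3) F} (hL : L.IsHomogeneous 1) (hL0 : L ≠ 0)
    (hLp : ∀ i, aeval (p i) L = 0)
    [FiniteDimensional F (MvPolynomial (Fin 3) F ⧸ (E ⊔ Ideal.span {L}))]
    (hcard : Fintype.card ι + finrank F (MvPolynomial (Fin 3) F ⧸ (E ⊔ Ideal.span {L})) = d + 2) :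
    ∃ v : ι → F, (∀ i, v i ≠ 0) ∧
      ∀ f ∈ E, f.IsHomogeneous d → ∑ i, v i * aeval (p i) f = 0 := by
  classical
  set K := E ⊔ Ideal.span {L}
  choose e heE hei hej using fun i => (hsep i)
  let g : ι → MvPolynomial (Fin 3) F := fun i => C (aeval (p i) (e i))⁻¹ * e i
  have hgE : ∀ i, g i ∈ E := fun i => E.mul_mem_left _ (heE i)
  have hg : ∀ i j, aeval (p j) (g i) = if j = i then (1 : F) else 0 := by
    intro i j
    rw [map_mul, aeval_C, Algebra.algebraMap_self, RingHom.id_apply]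
    split_ifs with h
    · subst h
      exact inv_mul_cancel₀ (hei j)
    · rw [hej i j h, mul_zero]
  have hgsum : ∀ (c : ι → F) j, aeval (p j) (∑ i, C (c i) * g i) = c j := by
    intro c j
    rw [map_sum, Finset.sum_eq_single j]
    · rw [map_mul, hg, if_pos rfl, mul_one, aeval_C, Algebra.algebraMap_self, RingHom.id_apply]
    · intro i _ hi
      rw [map_mul, hg, if_neg hi.symm, mul_zero]
    · simp
  have hgsumE : ∀ c : ι → F, ∑ i, C (c i) * g i ∈ E := fun c =>
    E.sum_mem fun i _ => E.mul_mem_left _ (hgE i)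
  have hlker : ∀ {κ : Type _} (r : κ → ι), l - 1 ∈ RingHom.ker (restrictEval (p ∘ r) K) := by
    intro κ r
    exact mem_ker_restrictEval.2 ⟨Ideal.mem_sup_left hlE, fun i => by
      rw [map_sub, map_one, Function.comp_apply, hlp, sub_self]⟩
  have hlker₀ : l - 1 ∈ RingHom.ker (restrictEval p K) := hlker id
  have hLker : ∀ x, x * L ∈ RingHom.ker (restrictEval p K) := fun x =>
    mem_ker_restrictEval.2 ⟨Ideal.mem_sup_right (Ideal.mem_span_singleton'.2 ⟨x, rfl⟩), fun i => by
      rw [map_mul, hLp, mul_zero]⟩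
  obtain ⟨hfin, -⟩ := finite_and_finrank_quotient_ker_restrictEval_le (p := p) K
  -- Separation makes the dimension exactly `d + 2`, one more than forms of degree `d` can fill on a
  -- line.
  have hsurj : Function.Surjective (restrictEval p K) := by
    rintro ⟨x, y⟩
    obtain ⟨f, rfl⟩ := Ideal.Quotient.mk_surjective x
    refine ⟨f + ∑ i, C (y i - aeval (p i) f) * g i, Prod.ext ?_ (funext fun j => ?_)⟩
    · change Ideal.Quotient.mk K _ = Ideal.Quotient.mk K _
      rw [Ideal.Quotient.eq, add_sub_cancel_left]
      exact Ideal.mem_sup_left (hgsumE _)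
    · change aeval (p j) _ = y j
      rw [map_add, hgsum (fun i => y i - aeval (p i) f)]
      ring
  have hdim : finrank F (MvPolynomial (Fin 3) F ⧸ RingHom.ker (restrictEval p K)) = d + 2 := by
    rw [(Ideal.quotientKerAlgEquivOfSurjective hsurj).toLinearEquiv.finrank_eq, finrank_prod,
      finrank_fintype_fun_eq_card, add_comm, hcard]
  have hforms : formsImage (RingHom.ker (restrictEval p K)) d < ⊤ := by
    refine lt_top_iff_ne_top.2 fun htop => ?_
    have := finrank_pow_le_succ (one_mem_formsImage_one hl hlker₀)
      (finrank_formsImage_one_le_two_iff.2 ⟨L, hL, hL0, by simpa using hLker 1⟩) d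
    rw [formsImage_one_pow, htop, finrank_top, hdim] at this
    lia
  obtain ⟨φ, hφ0, hφ⟩ := Submodule.exists_le_ker_of_lt_top _ hforms
  let θ := φ ∘ₗ (Ideal.Quotient.mkₐ F (RingHom.ker (restrictEval p K))).toLinearMap
  have hθd : ∀ f : MvPolynomial (Fin 3) F, f.IsHomogeneous d → θ f = 0 := fun f hf =>
    hφ (mem_formsImage.2 ⟨f, hf, rfl⟩)
  have hθker : ∀ f ∈ RingHom.ker (restrictEval p K), θ f = 0 := fun f hf => by
    have : Ideal.Quotient.mk (RingHom.ker (restrictEval p K)) f = 0 :=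
      Ideal.Quotient.eq_zero_iff_mem.2 hf
    exact (congrArg φ this).trans (map_zero φ)
  have hθ0 : θ ≠ 0 := fun h => hφ0 (LinearMap.ext fun x => by
    obtain ⟨f, rfl⟩ := Ideal.Quotient.mk_surjective x
    exact LinearMap.congr_fun h f)
  have hθE : ∀ f ∈ E, θ f = ∑ i, θ (g i) * aeval (p i) f := by
    intro f hf
    have := hθker (f - ∑ i, C (aeval (p i) f) * g i) (mem_ker_restrictEval.2
      ⟨Ideal.mem_sup_left (sub_mem hf (hgsumE _)), fun j => by
        rw [map_sub, hgsum (fun i => aeval (p i) f), sub_self]⟩)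
    rw [map_sub, sub_eq_zero, map_sum] at this
    rw [this]
    refine Finset.sum_congr rfl fun i _ => ?_
    rw [← smul_eq_C_mul, map_smul, smul_eq_mul, mul_comm]
  refine ⟨fun i => θ (g i), fun i hi => ?_, fun f hf hfd => (hθE f hf).symm.trans (hθd f hfd)⟩
  -- With weight zero at `i`, `θ` would descend to the scheme without that point, of degree at most
  -- `d + 1`.
  obtain ⟨h1, h2⟩ := finite_and_finrank_quotient_ker_restrictEval_le
    (p := fun j : {j // j ≠ i} => p j) K
  have h3 := add_two_le_finrank_quotient hl (hlker _) (J := RingHom.ker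
    (restrictEval (fun j : {j // j ≠ i} => p j) K)) (fun f hf => ?_) hθd hθ0
  · have : Fintype.card {j // j ≠ i} < Fintype.card ι :=
      Fintype.card_subtype_lt (p := fun j => j ≠ i) (x := i) fun h => h rfl
    omega
  · obtain ⟨hfK, hfp⟩ := mem_ker_restrictEval.1 hf
    obtain ⟨e, he, _, hx, rfl⟩ := Submodule.mem_sup.1 hfK
    obtain ⟨x, rfl⟩ := Ideal.mem_span_singleton'.1 hx
    rw [map_add, hθker _ (hLker x), add_zero, hθE e he]
    refine Finset.sum_eq_zero fun j _ => ?_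
    obtain rfl | hj := eq_or_ne j i
    · exact mul_eq_zero_of_left hi _
    · have := hfp ⟨j, hj⟩
      rw [map_add, map_mul, hLp, mul_zero, add_zero] at this
      rw [this, mul_zero]

end Affine

/-! ### Codewords and homogeneous coordinates -/

section Codes

open MvPolynomial

variable {F : Type*} [Field F]

theorem aeval_eq_zero_iff_vanishesAt {v : Fin 3 → F} {P : Plane F}
    (hv : ∃ h : v ≠ 0, Projectivization.mk F v h = P) {f : MvPolynomial (Fin 3) F} {n : ℕ}
    (hf : f.IsHomogeneous n) : aeval v f = 0 ↔ VanishesAt f P := by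
  obtain ⟨h, hP⟩ := hv
  rw [← P.mk_rep, Projectivization.mk_eq_mk_iff] at hP
  obtain ⟨a, rfl⟩ := hP
  have : aeval (a • P.rep) f = (a : F) ^ n * eval P.rep f := eval_smul_of_isHomogeneous hf a P.rep
  rw [this, VanishesAt, mul_eq_zero, or_iff_right (pow_ne_zero n a.ne_zero)]

theorem aeval_eq_pow_mul_aeval_normalized {l f : MvPolynomial (Fin 3) F} {c : Fin 3 → F} {n : ℕ}
    (hf : f.IsHomogeneous n) (hc : aeval c l ≠ (0 : F)) :
    aeval c f = aeval c l ^ n * aeval ((aeval c l : F)⁻¹ • c) f := by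
  have : aeval ((aeval c l : F)⁻¹ • c) f = ((aeval c l : F)⁻¹) ^ n * aeval c f :=
    eval_smul_of_isHomogeneous hf _ c
  rw [this, ← mul_assoc, ← mul_pow, mul_inv_cancel₀ hc, one_pow, one_mul]

theorem isHomogeneous_curveForm {q m : ℕ} (hq : 1 ≤ q) (hm : m ≤ q) :
    (curveForm F q m).IsHomogeneous q := by
  refine ((isHomogeneous_X_pow 1 q).add ?_).sub ?_
  · have := (isHomogeneous_X F (1 : Fin 3)).mul (isHomogeneous_X_pow (R := F) (2 : Fin 3) (q - 1))
    rwa [show 1 + (q - 1) = q by lia] at this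
  · have := (isHomogeneous_X_pow (R := F) (0 : Fin 3) m).mul
      (isHomogeneous_X_pow (R := F) (2 : Fin 3) (q - m))
    rwa [show m + (q - m) = q by lia] at this

theorem IsSaturated.mem_of_forall_isHomogeneous_mul_mem {I : HomIdeal F} (hI : IsSaturated I)
    {f : MvPolynomial (Fin 3) F} (n : ℕ)
    (h : ∀ g : MvPolynomial (Fin 3) F, g.IsHomogeneous n → g * f ∈ I.toIdeal) : f ∈ I.toIdeal := by
  induction n with
  | zero => simpa using h 1 (isHomogeneous_one _ _)
  | succ n ih =>
    refine ih fun g hg => hI _ fun i => ?_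
    have := h (X i * g) (add_comm 1 n ▸ (isHomogeneous_X F i).mul hg)
    rwa [mul_assoc] at this

theorem not_vanishesAt_of_isDisjointFrom {S : Set (Plane F)} {l : MvPolynomial (Fin 3) F}
    (h : IsDisjointFrom (pointsIdeal S).toIdeal l) (hl : l.IsHomogeneous 1) {P : Plane F}
    (hP : P ∈ S) : ¬ VanishesAt l P := by
  intro hlP
  obtain ⟨n, hn⟩ := h.exists
  obtain ⟨i, hi⟩ := exists_rep_ne_zero P
  obtain ⟨g, hg, hfg⟩ := hn (X i ^ (n + 1)) (isHomogeneous_X_pow i _)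
  have hhom := (isHomogeneous_X_pow (R := F) i (n + 1)).sub (add_comm 1 n ▸ hl.mul hg)
  have := (mem_pointsIdeal_of_isHomogeneous hhom).1 hfg P hP
  rw [VanishesAt] at this hlP
  rw [map_sub, map_mul, hlP, zero_mul, sub_zero, map_pow, eval_X] at this
  exact hi (pow_eq_zero_iff (n.succ_ne_zero) |>.1 this)

theorem mem_dualCode_uncompleteCode [Fintype F] {coord : Plane F → Fin 3 → F} {q m d : ℕ}
    {E : HomIdeal F} {v : evalSet q m E → F} :
    v ∈ dualCode (uncompleteCode coord q m d E) ↔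
      ∀ f ∈ E.toIdeal, f.IsHomogeneous d → ∑ P : evalSet q m E, aeval (coord P) f * v P = 0 := by
  constructor
  · intro h f hf hfd
    exact h _ ⟨⟨f, hfd⟩, hf, rfl⟩
  · rintro h _ ⟨f, hf, rfl⟩
    exact h f hf f.2

theorem hammingNorm_eq_ncard_wordSupport [DecidableEq F] {B : Set (Plane F)} [Fintype B]
    (w : B → F) : hammingNorm w = (wordSupport w).ncard := by
  classical
  rw [wordSupport, Set.ncard_image_of_injective _ Subtype.val_injective, hammingNorm,
    Set.ncard_eq_toFinset_card']
  congr 1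
  ext
  simp

end Codes

end HermitianQuotient

/-! ### The main theorem -/

open HermitianQuotient MvPolynomial in
theorem mainTheorem6 {F : Type*} [Field F] [Fintype F] [DecidableEq F]
    (q m d : ℕ) (hq : IsPrimePow q) (hF : Fintype.card F = q ^ 2)
    (hm : m ∣ q + 1) (hm' : m ≠ q + 1)
    (coord : HermitianQuotient.Plane F → Fin 3 → F)
    (hcoord : ∀ P, ∃ h : coord P ≠ 0, Projectivization.mk F (coord P) h = P)
    (E : HermitianQuotient.HomIdeal F)
    (hEsat : HermitianQuotient.IsSaturated E)
    (hEdim : HermitianQuotient.IsZeroDim E)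
    (hEY : HermitianQuotient.curveForm F q m ∈ E)
    (hd : 0 < d) (hdm : d + 2 ≤ m)
    (hEdeg : HermitianQuotient.degree E + 1 ≤ d)
    (w : HermitianQuotient.evalSet q m E → F)
    (hw : w ∈ HermitianQuotient.dualCode (HermitianQuotient.uncompleteCode coord q m d E))
    (hw0 : w ≠ 0)
    (S : Set (HermitianQuotient.Plane F)) (hS : S = HermitianQuotient.wordSupport w)
    (hES : HermitianQuotient.degree
      (HermitianQuotient.union E (HermitianQuotient.pointsIdeal S)) ≤ 2 * d + 1) :
    ∃ L : HermitianQuotient.Line F,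
      (S ⊆ L.points ∧
        d + 2 ≤ HermitianQuotient.degree (HermitianQuotient.inter
          (HermitianQuotient.union E (HermitianQuotient.pointsIdeal S)) L.ideal)) ∧
      (∀ S' : Set (HermitianQuotient.Plane F), S' ⊆ S ∩ L.points →
        S'.ncard + HermitianQuotient.degree (HermitianQuotient.inter E L.ideal) = d + 2 →
        ∃ w' ∈ HermitianQuotient.dualCode (HermitianQuotient.uncompleteCode coord q m d E),
          HermitianQuotient.wordSupport w' = S' ∧
          hammingNorm w' + HermitianQuotient.degree (HermitianQuotient.inter E L.ideal)
            = d + 2) ∧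
      (HermitianQuotient.IsMinWeight
          (HermitianQuotient.dualCode (HermitianQuotient.uncompleteCode coord q m d E)) w →
        S.ncard + HermitianQuotient.degree (HermitianQuotient.inter E L.ideal) = d + 2) := by
  classical
  have hq2 : 2 ≤ q := hq.two_le
  have hmq : m ≤ q := by
    have := Nat.le_of_dvd (by lia) hm
    lia
  have hSB : S ⊆ evalSet q m E := by
    rw [hS]
    rintro _ ⟨P, -, rfl⟩
    exact P.2
  have hSfin : S.Finite := (Set.toFinite (evalSet q m E)).subset hSB
  have hSE : Disjoint S (redPoints E) :=
    Set.disjoint_left.2 fun P hP h => (hSB hP).2 (Or.inl h)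
  have hwS : ∀ P : evalSet q m E, w P ≠ 0 ↔ P.1 ∈ S := by
    intro P
    rw [hS, wordSupport, Subtype.val_injective.mem_set_image, Function.mem_support]
  set Z := union E (pointsIdeal S)
  have hZsat : IsSaturated Z := isSaturated_union_pointsIdeal hEsat S
  have hZdim : IsZeroDim Z := isZeroDim_union_pointsIdeal hEdim hSfin hSE
  have hZE : Z.toIdeal ≤ E.toIdeal := inf_le_left
  have hZS : Z.toIdeal ≤ (pointsIdeal S).toIdeal := inf_le_right
  have hZY : curveForm F q m ∈ Z :=
    ⟨hEY, (mem_pointsIdeal_of_isHomogeneous (isHomogeneous_curveForm (by lia) hmq)).2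
      fun P hP => (hSB hP).1⟩
  -- Here `2 * d + 1 < q ^ 2`, because `d + 2 ≤ m ≤ q`.
  obtain ⟨t, ht⟩ := exists_pencil_nonzerodivisor hZsat hZdim
    (by rw [hF]; nlinarith) fun x => hZsat.mem_of_X_zero_mul_mem hq2 (by lia) hZY
  set l : MvPolynomial (Fin 3) F := X 0 + C t * X 2
  have hl : l.IsHomogeneous 1 := isHomogeneous_pencil t
  have hZl : IsDisjointFrom Z.toIdeal l := hZdim.isDisjointFrom hl ht
  have hSl : IsDisjointFrom (pointsIdeal S).toIdeal l := hZl.mono hZS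
  -- Modulo the ideal of `S`, every form `g` of degree `n + 1` is a multiple `l * g'`. Then `(g - l
  -- * g') * f` is in the ideal of `Z`, hence `g * f` in that of `E`, and saturation concludes.
  have hEl : ∀ f, l * f ∈ E.toIdeal → f ∈ E.toIdeal := by
    intro f hf
    obtain ⟨n, hn⟩ := hSl.exists
    refine hEsat.mem_of_forall_isHomogeneous_mul_mem (n + 1) fun g hg => ?_
    obtain ⟨g', -, hgg'⟩ := hn g hg
    have h1 : (g - l * g') * f ∈ E.toIdeal := hZE (ht _ ⟨?_, ?_⟩)
    · convert add_mem h1 (E.toIdeal.mul_mem_left g' hf) using 1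
      ring
    · have := E.toIdeal.mul_mem_left (g - l * g') hf
      rwa [mul_left_comm] at this
    · exact Ideal.mul_mem_left _ _ (Ideal.mul_mem_right _ _ hgg')
  have hlc : ∀ P ∈ S, aeval (coord P) l ≠ (0 : F) := fun P hP h =>
    not_vanishesAt_of_isDisjointFrom hSl hl hP ((aeval_eq_zero_iff_vanishesAt (hcoord P) hl).1 h)
  -- Representatives are rescaled to lie on `l = 1`; weights then change by the nonzero factor `l
  -- (coord P) ^ d`.
  let p : Plane F → Fin 3 → F := fun P => (aeval (coord P) l : F)⁻¹ • coord P
  have hp : ∀ P ∈ S, ∀ {n : ℕ} {f : MvPolynomial (Fin 3) F}, f.IsHomogeneous n →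
      (aeval (coord P) f : F) = aeval (coord P) l ^ n * aeval (p P) f := fun P hP _ _ hf =>
    aeval_eq_pow_mul_aeval_normalized hf (hlc P hP)
  have hpv : ∀ P ∈ S, ∀ {n : ℕ} {f : MvPolynomial (Fin 3) F}, f.IsHomogeneous n →
      ((aeval (p P) f : F) = 0 ↔ VanishesAt f P) := by
    intro P hP n f hf
    rw [← aeval_eq_zero_iff_vanishesAt (hcoord P) hf, hp P hP hf, mul_eq_zero,
      or_iff_right (pow_ne_zero n (hlc P hP))]
  have hpl : ∀ P ∈ S, aeval (p P) l = (1 : F) := by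
    intro P hP
    have := hp P hP hl
    rw [pow_one] at this
    exact (mul_eq_left₀ (hlc P hP)).1 this.symm
  set E' := E.toIdeal ⊔ Ideal.span {l - 1} with hE'
  set Z' := Z.toIdeal ⊔ Ideal.span {l - 1} with hZ'
  have hlE' : l - 1 ∈ E' := Ideal.mem_sup_right (Ideal.mem_span_singleton_self _)
  have hlZ' : l - 1 ∈ Z' := Ideal.mem_sup_right (Ideal.mem_span_singleton_self _)
  have hZE' : Z' ≤ E' := sup_le_sup_right hZE _
  have hZp : ∀ f ∈ Z', ∀ P ∈ S, aeval (p P) f = (0 : F) := by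
    intro f hf P hP
    have : Z' ≤ RingHom.ker (aeval (p P) : MvPolynomial (Fin 3) F →ₐ[F] F) := by
      refine sup_le (hZS.trans (Ideal.span_le.2 ?_)) ((Ideal.span_singleton_le_iff_mem _).2 ?_)
      · rintro f ⟨n, hf, hfS⟩
        exact (hpv P hP hf).2 (hfS P hP)
      · rw [RingHom.mem_ker, map_sub, map_one, hpl P hP, sub_self]
    exact this hf
  obtain ⟨hZfin, hZdeg⟩ := hZl.degree_eq hl
  obtain ⟨hEfin, hEdeg'⟩ := (hZl.mono hZE).degree_eq hl
  have hdegZL : ∀ L : Line F, degree (inter Z L.ideal) =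
      finrank F (MvPolynomial (Fin 3) F ⧸ (Z' ⊔ Ideal.span {L.form})) := by
    intro L
    have := (IsDisjointFrom.degree_eq (J := inter Z L.ideal) hl (hZl.mono le_sup_left)).2
    rw [this, hZ', sup_right_comm]
    rfl
  have hdegEL : ∀ L : Line F, degree (inter E L.ideal) =
      finrank F (MvPolynomial (Fin 3) F ⧸ (E' ⊔ Ideal.span {L.form})) := by
    intro L
    have := (IsDisjointFrom.degree_eq (J := inter E L.ideal) hl
      ((hZl.mono hZE).mono le_sup_left)).2
    rw [this, hE', sup_right_comm]
    rfl
  have hELsurj : ∀ L, Function.Surjective (Ideal.Quotient.factorₐ F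
      (le_sup_left : E' ≤ E' ⊔ Ideal.span {L})).toLinearMap := fun L =>
    Ideal.Quotient.factor_surjective (le_sup_left : E' ≤ E' ⊔ Ideal.span {L})
  have hELfin : ∀ L, FiniteDimensional F
      (MvPolynomial (Fin 3) F ⧸ (E' ⊔ Ideal.span {L})) := fun L =>
    Module.Finite.of_surjective _ (hELsurj L)
  have hsep : ∀ T ⊆ S, ∀ P : {P : evalSet q m E // P.1 ∈ T}, ∃ f ∈ E', aeval (p P.1) f ≠ (0 : F) ∧
      ∀ P' : {P : evalSet q m E // P.1 ∈ T}, P' ≠ P → aeval (p P'.1) f = (0 : F) := by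
    intro T hT P
    obtain ⟨n, hn⟩ := (eventually_exists_separating hSfin hSE).exists
    obtain ⟨f, hfE, hf, hfP, hfP'⟩ := hn P.1 (hT P.2)
    refine ⟨f, Ideal.mem_sup_left hfE, fun h => hfP ((hpv _ (hT P.2) hf).1 h), fun P' hne => ?_⟩
    exact (hpv _ (hT P'.2) hf).2 (hfP' _ (hT P'.2) fun h => hne (Subtype.ext (Subtype.ext h)))
  have hcard : ∀ T ⊆ S, Fintype.card {P : evalSet q m E // P.1 ∈ T} = T.ncard := by
    intro T hT
    rw [← Nat.card_eq_fintype_card]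
    refine Set.ncard_preimage_of_injective_subset_range Subtype.val_injective ?_
    rw [Subtype.range_val]
    exact hT.trans hSB
  have hsum : ∀ T ⊆ S, ∀ v : evalSet q m E → F, (∀ P, P.1 ∉ T → v P = 0) →
      ∀ f : MvPolynomial (Fin 3) F, f.IsHomogeneous d →
      ∑ P : evalSet q m E, aeval (coord P) f * v P =
        ∑ P : {P : evalSet q m E // P.1 ∈ T}, (v P * aeval (coord P.1) l ^ d) * aeval (p P.1) f := by
    intro T hT v hv f hf
    rw [← Fintype.sum_subtype_add_sum_subtype (fun P : evalSet q m E => P.1 ∈ T)]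
    rw [Finset.sum_eq_zero (s := (Finset.univ : Finset {P : evalSet q m E // P.1 ∉ T}))
      (fun P _ => by rw [hv P P.2, mul_zero]), add_zero]
    refine Finset.sum_congr rfl fun P _ => ?_
    rw [hp _ (hT P.2) hf]
    ring
  have hne : Nonempty {P : evalSet q m E // P.1 ∈ S} := by
    obtain ⟨P, hP⟩ := Function.ne_iff.1 hw0
    exact ⟨⟨P, (hwS P).1 hP⟩⟩
  obtain ⟨L, hL, hL0, hLp, hLZ, hLE⟩ := exists_line_of_relation
    (p := fun P : {P : evalSet q m E // P.1 ∈ S} => p P.1)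
    (v := fun P => w P * aeval (coord P.1) l ^ d) (d := d) hl hlZ' hZE'
    (fun f hf P => hZp f hf _ P.2) (hsep S subset_rfl) (hZdeg ▸ hES)
    (fun P => mul_ne_zero ((hwS P).2 P.2) (pow_ne_zero _ (hlc _ P.2)))
    (fun f hf hfd => by
      rw [← hsum S subset_rfl w (fun P hP => not_not.1 (mt (hwS P).1 hP)) f hfd]
      exact mem_dualCode_uncompleteCode.1 hw f (mem_of_mem_sup_span_sub_one hl hEl hfd hf) hfd)
  let M : Line F := ⟨L, hL, hL0⟩
  have hSL : S ⊆ M.points := fun P hP => (hpv P hP hL).1 (hLp ⟨⟨P, hSB hP⟩, hP⟩)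
  have hcode : ∀ S' : Set (Plane F), S' ⊆ S ∩ M.points →
      S'.ncard + degree (inter E M.ideal) = d + 2 →
      ∃ w' ∈ dualCode (uncompleteCode coord q m d E), wordSupport w' = S' ∧
        hammingNorm w' + degree (inter E M.ideal) = d + 2 := by
    intro S' hS' hS'card
    have hS'S : S' ⊆ S := hS'.trans Set.inter_subset_left
    have := hELfin L
    obtain ⟨v, hv0, hv⟩ := exists_relation_of_line
      (p := fun P : {P : evalSet q m E // P.1 ∈ S'} => p P.1) (d := d) hl hlE'
      (fun P => hpl _ (hS'S P.2)) (hsep S' hS'S) hL hL0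
      (fun P => hLp ⟨P.1, hS'S P.2⟩) (by rw [hcard S' hS'S, ← hS'card, hdegEL M])
    let w' : evalSet q m E → F := fun P =>
      if h : P.1 ∈ S' then v ⟨P, h⟩ * (aeval (coord P) l ^ d)⁻¹ else 0
    have hw' : ∀ P (h : P.1 ∈ S'), w' P = v ⟨P, h⟩ * (aeval (coord P) l ^ d)⁻¹ :=
      fun P h => dif_pos h
    have hw'0 : ∀ P, P.1 ∉ S' → w' P = 0 := fun P h => dif_neg h
    have hsupp : wordSupport w' = S' := by
      refine Set.Subset.antisymm ?_ fun P hP => ⟨⟨P, hSB (hS'S hP)⟩, ?_, rfl⟩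
      · rintro _ ⟨P, hP, rfl⟩
        by_contra h
        exact hP (hw'0 P h)
      · rw [Function.mem_support, hw' _ hP]
        exact mul_ne_zero (hv0 _) (inv_ne_zero (pow_ne_zero _ (hlc P (hS'S hP))))
    refine ⟨w', mem_dualCode_uncompleteCode.2 fun f hf hfd => ?_, hsupp, ?_⟩
    · rw [hsum S' hS'S w' hw'0 f hfd, ← hv f (Ideal.mem_sup_left hf) hfd]
      refine Finset.sum_congr rfl fun P _ => ?_
      rw [hw' P P.2, inv_mul_cancel_right₀ (pow_ne_zero _ (hlc _ (hS'S P.2)))]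
    · rw [hammingNorm_eq_ncard_wordSupport, hsupp, hS'card]
  refine ⟨M, ⟨hSL, (hdegZL M).symm ▸ hLZ⟩, hcode, fun hmin => ?_⟩
  rw [hcard S subset_rfl] at hLE
  have hML := hdegEL M
  change _ = finrank F (MvPolynomial (Fin 3) F ⧸ (E' ⊔ Ideal.span {L})) at hML
  rw [← hML] at hLE
  have hle : degree (inter E M.ideal) ≤ degree E := by
    rw [hML, hEdeg']
    exact LinearMap.finrank_le_finrank_of_surjective (hELsurj L)
  -- `hLE` supplies enough points for the truncated subtraction, and `degree E < d` makes the size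
  -- positive, so the new codeword is nonzero.
  obtain ⟨S', hS'S, hS'card⟩ := Set.exists_subset_card_eq
    (show d + 2 - degree (inter E M.ideal) ≤ S.ncard by omega)
  obtain ⟨w', hw', hsupp, hnorm⟩ := hcode S' (fun P hP => ⟨hS'S hP, hSL (hS'S hP)⟩) (by omega)
  have hw'0 : w' ≠ 0 := by
    rintro rfl
    rw [hammingNorm_zero] at hnorm
    omega
  have hmin' := hmin.2.2 w' hw' hw'0
  rw [hammingNorm_eq_ncard_wordSupport w, ← hS] at hmin'
  omega
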